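/- Let $n\ge 2$. A two-neighbor $n$-state rule is a function $f:\mathbb{Z}_n^2\to\mathbb{Z}_n$; it acts on configurations $\xi:\mathbb{Z}\to\mathbb{Z}_n$ by $(F\xi)(x)=f(\xi(x-1),\xi(x))$. The rule is additive if $F$ commutes with sitewise addition modulo $n$, equivalently if $f(c_0,c_1)=bc_0+ac_1$ for some $a,b\in\mathbb{Z}_n$. A configuration $\xi$ is a periodic solution of $f$ with spatial period $\sigma$ and temporal period $\tau$ if $\sigma$ is the smallest positive integer with $\xi(x+\sigma)=\xi(x)$ for all $x\in\mathbb{Z}$, and $\tau$ is the smallest positive integer with $F^{\tau}\xi=\xi$. Let $\pi_\sigma(n)$ be the largest temporal period of a periodic solution with spatial period $\sigma$, over all additive two-neighbor $n$-state rules. Let $\lambda_2(n)$, $\lambda_3(n)$, $\lambda_4(n)$ be the exponents of the unit groups of, respectively, $\mathbb{Z}_n$, the Eisenstein integers modulo $n$, $\mathbb{Z}_n[\omega]$ with $\omega^2=-1-\omega$, and the Gaussian integers modulo $n$, $\mathbb{Z}_n[i]$ with $i^2=-1$. **Theorem.** The maxima below exist, and - $\pi_2(n)=\lambda_2(2n)$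 for all $n\ge 2$; - $\pi_3(2)=3$, and $\pi_3(n)=\lambda_3(3n)$ for all $n\ge 3$; - $\pi_4(2)=4$, and $\pi_4(n)=\lambda_4(n)$ for all $n\ge 3$; - $\pi_6(n)=\lambda_3(6n)$ for all $n\ge 2$. -/

import Mathlib

/-- A spatial configuration with `n` states: a colouring of the sites `ℤ` by `ZMod n`. -/
abbrev CAConfig (n : ℕ) : Type := ℤ → ZMod n

/-- One step of the two-neighbor cellular automaton with local rule `f`:
the new state at `x` is `f (ξ (x - 1)) (ξ x)`. -/
def caStep {n : ℕ} (f : ZMod n → ZMod n → ZMod n) (ξ : CAConfig n) : CAConfig n :=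
  fun x => f (ξ (x - 1)) (ξ x)

/-- A rule is additive if its evolution commutes with sitewise addition modulo `n`. -/
def IsAdditiveRule {n : ℕ} (f : ZMod n → ZMod n → ZMod n) : Prop :=
  ∀ ξ η : CAConfig n, caStep f (ξ + η) = caStep f ξ + caStep f η

/-- `σ` is the spatial period of `ξ`: the smallest positive period of `ξ`. -/
def HasSpatialPeriod {n : ℕ} (ξ : CAConfig n) (σ : ℕ) : Prop :=
  IsLeast {s : ℕ | 0 < s ∧ ∀ x : ℤ, ξ (x + s) = ξ x} σ

/-- `ξ` is a periodic solution of the rule `f` with temporal period `τ` and spatial period `σ`: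
`σ` is the smallest positive period of `ξ`, and `τ` is the smallest positive number of steps
after which the evolution from `ξ` returns to `ξ`. -/
def IsPeriodicSolution {n : ℕ} (f : ZMod n → ZMod n → ZMod n) (ξ : CAConfig n)
    (τ σ : ℕ) : Prop :=
  HasSpatialPeriod ξ σ ∧ IsLeast {t : ℕ | 0 < t ∧ (caStep f)^[t] ξ = ξ} τ

/-- The set of all temporal periods of periodic solutions with spatial period `σ` of
`n`-state additive rules. -/
def additivePeriods (σ n : ℕ) : Set ℕ :=
  {τ | ∃ f : ZMod n → ZMod n → ZMod n, IsAdditiveRule f ∧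
    ∃ ξ : CAConfig n, IsPeriodicSolution f ξ τ σ}

/-- `p = π_σ(n)`: `p` is the largest temporal period of a periodic solution with spatial
period `σ` of an `n`-state additive rule; in particular this maximum exists. -/
def IsMaxAdditivePeriod (σ n p : ℕ) : Prop :=
  IsGreatest (additivePeriods σ n) p

/-- Eisenstein integers modulo `n`: elements `a + b ω` with `a b : ZMod n` and
`ω ^ 2 = -1 - ω`. -/
abbrev EisensteinMod (n : ℕ) : Type := QuadraticAlgebra (ZMod n) (-1) (-1)

/-- Gaussian integers modulo `n`: elements `a + b i` with `a b : ZMod n` and `i ^ 2 = -1`. -/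
abbrev GaussianMod (n : ℕ) : Type := QuadraticAlgebra (ZMod n) (-1) 0

/-- The exponent of the unit group of the integers modulo `n`. -/
noncomputable def lambdaTwo (n : ℕ) : ℕ := Monoid.exponent (ZMod n)ˣ

/-- The exponent of the unit group of the Eisenstein integers modulo `n`. -/
noncomputable def lambdaThree (n : ℕ) : ℕ := Monoid.exponent (EisensteinMod n)ˣ

/-- The exponent of the unit group of the Gaussian integers modulo `n`. -/
noncomputable def lambdaFour (n : ℕ) : ℕ := Monoid.exponent (GaussianMod n)ˣ

/-- A rule is additive exactly when it is a linear form in the two neighbors. -/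
theorem isAdditiveRule_iff {n : ℕ} (f : ZMod n → ZMod n → ZMod n) :
    IsAdditiveRule f ↔ ∃ a b : ZMod n, ∀ c₀ c₁ : ZMod n, f c₀ c₁ = b * c₀ + a * c₁ := by
  constructor
  · intro h
    have key : ∀ u v u' v' : ZMod n, f (u + u') (v + v') = f u v + f u' v' := by
      intro u v u' v'
      have := congrFun (h (fun x => if x = 0 then v else u) (fun x => if x = 0 then v' else u')) 0
      simpa [caStep] using this
    let g : ZMod n × ZMod n →+ ZMod n :=
      AddMonoidHom.mk' (fun p => f p.1 p.2) (fun p q => key p.1 p.2 q.1 q.2)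
    have hl : ∀ (k : ZMod n →+ ZMod n) (c : ZMod n), k c = k 1 * c := by
      intro k c
      have := ZMod.map_smul k c 1
      simpa [mul_comm] using this
    refine ⟨g (0, 1), g (1, 0), fun c₀ c₁ => ?_⟩
    have h1 := hl (g.comp (AddMonoidHom.inl _ _)) c₀
    have h2 := hl (g.comp (AddMonoidHom.inr _ _)) c₁
    have h3 : f c₀ c₁ = f c₀ 0 + f 0 c₁ := by simpa using key c₀ 0 0 c₁
    rw [h3]
    exact congrArg₂ (· + ·) h1 h2
  · rintro ⟨a, b, h⟩ ξ η
    funext x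
    simp only [caStep, h, Pi.add_apply]
    ring

/-- The linear rule with coefficients `a`, `b` as an endomorphism of configurations over a
commutative ring. -/
def linStep {R : Type*} [CommRing R] (a b : R) : Module.End R (ℤ → R) where
  toFun ξ := fun x => b * ξ (x - 1) + a * ξ x
  map_add' ξ η := by
    funext x
    simp only [Pi.add_apply]
    ring
  map_smul' c ξ := by
    funext x
    simp only [Pi.smul_apply, smul_eq_mul, RingHom.id_apply]
    ring

theorem linStep_apply {R : Type*} [CommRing R] (a b : R) (ξ : ℤ → R) (x : ℤ) :
    linStep a b ξ x = b * ξ (x - 1) + a * ξ x := rfl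

theorem caStep_iterate_eq_linStep_pow {n : ℕ} {f : ZMod n → ZMod n → ZMod n} {a b : ZMod n}
    (h : ∀ c₀ c₁, f c₀ c₁ = b * c₀ + a * c₁) (t : ℕ) (ξ : CAConfig n) :
    (caStep f)^[t] ξ = (linStep a b ^ t) ξ := by
  have : caStep f = linStep a b := by
    funext η x
    exact h _ _
  rw [this, Module.End.pow_apply]

theorem comp_linStep_pow {R S : Type*} [CommRing R] [CommRing S] (g : R →+* S) (a b : R) (t : ℕ)
    (ξ : ℤ → R) : g ∘ (linStep a b ^ t) ξ = (linStep (g a) (g b) ^ t) (g ∘ ξ) := by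
  induction t with
  | zero => rfl
  | succ t ih =>
    rw [pow_succ', pow_succ', Module.End.mul_apply, Module.End.mul_apply, ← ih]
    funext x
    simp [linStep_apply]

theorem pow_mul_fixed {M : Type*} [AddCommMonoid M] {R : Type*} [Semiring R] [Module R M]
    {F : Module.End R M} {t : ℕ} {ξ : M} (h : (F ^ t) ξ = ξ) (s : ℕ) : (F ^ (t * s)) ξ = ξ := by
  induction s with
  | zero => rfl
  | succ s ih => rw [Nat.mul_succ, pow_add, Module.End.mul_apply, h, ih]

/-- Some linear rule modulo `n` has a temporally periodic solution whose period is a multiple of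
`L` and which, for `n > 1`, has least spatial period `σ`. -/
def HasPeriodMultiple (σ n L : ℕ) : Prop :=
  ∃ (a b : ZMod n) (ξ : CAConfig n), (∃ t, 0 < t ∧ (linStep a b ^ t) ξ = ξ) ∧
    (∀ t, (linStep a b ^ t) ξ = ξ → L ∣ t) ∧ (∀ x : ℤ, ξ (x + σ) = ξ x) ∧
    (1 < n → ∀ d : ℕ, (∀ x : ℤ, ξ (x + d) = ξ x) → σ ∣ d)

/-- Every temporally periodic solution modulo `n` with spatial period dividing `σ` returns after
`L` steps. -/
def PeriodsDivide (σ n L : ℕ) : Prop :=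
  ∀ (a b : ZMod n) (ξ : CAConfig n), (∀ x : ℤ, ξ (x + σ) = ξ x) →
    ∀ t, 0 < t → (linStep a b ^ t) ξ = ξ → (linStep a b ^ L) ξ = ξ

theorem HasPeriodMultiple.mono {σ n L L' : ℕ} (h : HasPeriodMultiple σ n L) (hL : L' ∣ L) :
    HasPeriodMultiple σ n L' := by
  obtain ⟨a, b, ξ, h1, h2, h3, h4⟩ := h
  exact ⟨a, b, ξ, h1, fun t ht => hL.trans (h2 t ht), h3, h4⟩

theorem isMaxAdditivePeriod_of {σ n L : ℕ} (hn : 2 ≤ n) (hσ : 0 < σ) (hL : 0 < L)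
    (hlow : HasPeriodMultiple σ n L) (hup : PeriodsDivide σ n L) :
    IsMaxAdditivePeriod σ n L := by
  constructor
  · obtain ⟨a, b, ξ, ⟨t, ht, hfix⟩, hdvd, hper, hmin⟩ := hlow
    refine ⟨fun c₀ c₁ => b * c₀ + a * c₁, (isAdditiveRule_iff _).2 ⟨a, b, fun _ _ => rfl⟩, ξ,
      ⟨⟨hσ, hper⟩, ?_⟩, ⟨⟨hL, ?_⟩, ?_⟩⟩
    · rintro d ⟨hd, hd'⟩
      exact Nat.le_of_dvd hd (hmin (by omega) d hd')
    · rw [caStep_iterate_eq_linStep_pow (fun _ _ => rfl)]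
      exact hup a b ξ hper t ht hfix
    · rintro s ⟨hs, hs'⟩
      rw [caStep_iterate_eq_linStep_pow (fun _ _ => rfl)] at hs'
      exact Nat.le_of_dvd hs (hdvd s hs')
  · rintro τ ⟨f, hf, ξ, ⟨⟨-, hper⟩, -⟩, ⟨hτ, hfix⟩, hmin⟩
    obtain ⟨a, b, hab⟩ := (isAdditiveRule_iff f).1 hf
    rw [caStep_iterate_eq_linStep_pow hab] at hfix
    refine hmin ⟨hL, ?_⟩
    rw [caStep_iterate_eq_linStep_pow hab]
    exact hup a b ξ hper τ hτ hfix

theorem HasPeriodMultiple.mul {σ m n L M : ℕ} (hmn : m.Coprime n)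
    (h₁ : HasPeriodMultiple σ m L) (h₂ : HasPeriodMultiple σ n M) :
    HasPeriodMultiple σ (m * n) (L.lcm M) := by
  obtain ⟨a₁, b₁, ξ₁, ⟨t₁, ht₁, hf₁⟩, hL₁, hp₁, hm₁⟩ := h₁
  obtain ⟨a₂, b₂, ξ₂, ⟨t₂, ht₂, hf₂⟩, hL₂, hp₂, hm₂⟩ := h₂
  let e := ZMod.chineseRemainder hmn
  let g₁ : ZMod (m * n) →+* ZMod m := (RingHom.fst _ _).comp e.toRingHom
  let g₂ : ZMod (m * n) →+* ZMod n := (RingHom.snd _ _).comp e.toRingHom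
  have hg₁ : ∀ u v, g₁ (e.symm (u, v)) = u := fun u v => by simp [g₁]
  have hg₂ : ∀ u v, g₂ (e.symm (u, v)) = v := fun u v => by simp [g₂]
  have hext : ∀ u v : ZMod (m * n), u = v ↔ g₁ u = g₁ v ∧ g₂ u = g₂ v := fun u v =>
    ⟨by rintro rfl; exact ⟨rfl, rfl⟩, fun h => e.injective (Prod.ext h.1 h.2)⟩
  let ξ : CAConfig (m * n) := fun x => e.symm (ξ₁ x, ξ₂ x)
  have hξ₁ : g₁ ∘ ξ = ξ₁ := funext fun x => hg₁ _ _
  have hξ₂ : g₂ ∘ ξ = ξ₂ := funext fun x => hg₂ _ _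
  have hstep : ∀ t, (linStep (e.symm (a₁, a₂)) (e.symm (b₁, b₂)) ^ t) ξ = ξ ↔
      (linStep a₁ b₁ ^ t) ξ₁ = ξ₁ ∧ (linStep a₂ b₂ ^ t) ξ₂ = ξ₂ := by
    intro t
    have k₁ := comp_linStep_pow g₁ (e.symm (a₁, a₂)) (e.symm (b₁, b₂)) t ξ
    have k₂ := comp_linStep_pow g₂ (e.symm (a₁, a₂)) (e.symm (b₁, b₂)) t ξ
    rw [hg₁, hg₁, hξ₁] at k₁
    rw [hg₂, hg₂, hξ₂] at k₂
    constructor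
    · intro h
      rw [← k₁, ← k₂, h]
      exact ⟨hξ₁, hξ₂⟩
    · rintro ⟨h₁, h₂⟩
      funext x
      rw [hext]
      exact ⟨(congrFun k₁ x).trans ((congrFun h₁ x).trans (hg₁ _ _).symm),
        (congrFun k₂ x).trans ((congrFun h₂ x).trans (hg₂ _ _).symm)⟩
  have hper : ∀ d : ℕ, (∀ x : ℤ, ξ (x + d) = ξ x) ↔
      (∀ x : ℤ, ξ₁ (x + d) = ξ₁ x) ∧ (∀ x : ℤ, ξ₂ (x + d) = ξ₂ x) := by
    intro d
    simp only [ξ, EmbeddingLike.apply_eq_iff_eq, Prod.mk.injEq, forall_and]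
  refine ⟨e.symm (a₁, a₂), e.symm (b₁, b₂), ξ, ⟨t₁ * t₂, Nat.mul_pos ht₁ ht₂, ?_⟩, ?_, ?_, ?_⟩
  · rw [hstep]
    refine ⟨pow_mul_fixed hf₁ _, ?_⟩
    rw [mul_comm]
    exact pow_mul_fixed hf₂ _
  · intro t ht
    rw [hstep] at ht
    exact Nat.lcm_dvd (hL₁ t ht.1) (hL₂ t ht.2)
  · rw [hper]
    exact ⟨hp₁, hp₂⟩
  · intro h1 d hd
    rw [hper] at hd
    have : 1 < m ∨ 1 < n := by
      by_contra! hcon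
      nlinarith [Nat.mul_le_mul hcon.1 hcon.2]
    rcases this with h | h
    · exact hm₁ h d hd.1
    · exact hm₂ h d hd.2

theorem hasPeriodMultiple_of_algebra {σ n L : ℕ} {A : Type*} [CommRing A] [Finite A]
    [Algebra (ZMod n) A] (x : Aˣ) (φ : A →ₗ[ZMod n] ZMod n)
    (hφ : ∀ w : A, (∀ k : ℕ, φ ((x : A) ^ k * w) = 0) → w = 0) (hx : x ^ σ = 1)
    (hσ : 1 < n → σ ∣ orderOf x) (a b : ZMod n) (T : Aˣ)
    (hT : (T : A) = algebraMap (ZMod n) A a + algebraMap (ZMod n) A b * x)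
    (hL : L ∣ orderOf T) : HasPeriodMultiple σ n L := by
  let c : A → CAConfig n := fun u y => φ (((x ^ (-y) : Aˣ) : A) * u)
  have hc : ∀ u v, c u = c v ↔ u = v := by
    refine fun u v => ⟨fun h => sub_eq_zero.1 (hφ _ fun k => ?_), fun h => h ▸ rfl⟩
    have := congrFun h (-(k : ℤ))
    simp only [c, neg_neg, zpow_natCast, Units.val_pow_eq_pow_val] at this
    rw [mul_sub, map_sub, this, sub_self]
  have hstep : ∀ u, linStep a b (c u) = c (T * u) := by
    intro u
    funext y
    have h1 : ((x ^ (-(y - 1)) : Aˣ) : A) = (x ^ (-y) : Aˣ) * x := by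
      rw [← Units.val_mul]
      congr 1
      rw [← zpow_add_one]
      congr 1
      ring
    have h2 : ((x ^ (-y) : Aˣ) : A) * (T * u) =
        b • ((x ^ (-y) : Aˣ) * x * u) + a • ((x ^ (-y) : Aˣ) * u) := by
      rw [hT, Algebra.smul_def, Algebra.smul_def]
      ring
    simp only [linStep_apply, c, h1, h2, map_add, map_smul, smul_eq_mul]
  have hpow : ∀ t, (linStep a b ^ t) (c 1) = c ((T ^ t : Aˣ) : A) := by
    intro t
    induction t with
    | zero => simp
    | succ t ih =>
      rw [pow_succ', Module.End.mul_apply, ih, hstep, pow_succ', Units.val_mul]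
  have hfix : ∀ t, (linStep a b ^ t) (c 1) = c 1 ↔ T ^ t = 1 := by
    intro t
    rw [hpow, hc, Units.val_eq_one]
  have hshift : ∀ (d : ℕ), (∀ y : ℤ, c 1 (y + d) = c 1 y) ↔ x ^ d = 1 := by
    intro d
    have h : (∀ y : ℤ, c 1 (y + d) = c 1 y) ↔ c ((x ^ (-(d : ℤ)) : Aˣ) : A) = c 1 := by
      rw [funext_iff]
      refine forall_congr' fun y => ?_
      simp only [c, neg_add, zpow_add, Units.val_mul, mul_one]
    rw [h, hc, Units.val_eq_one, zpow_neg, inv_eq_one, zpow_natCast]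
  refine ⟨a, b, c 1, ⟨orderOf T, orderOf_pos T, (hfix _).2 (pow_orderOf_eq_one T)⟩,
    fun t ht => hL.trans (orderOf_dvd_of_pow_eq_one ((hfix t).1 ht)), (hshift σ).2 hx,
    fun hn d hd => (hσ hn).trans (orderOf_dvd_of_pow_eq_one ((hshift d).1 hd))⟩

theorem hasPeriodMultiple_shift {σ n : ℕ} (hσ : 0 < σ) (hn : 1 < n) :
    HasPeriodMultiple σ n σ := by
  have : Fact (1 < n) := ⟨hn⟩
  let ξ : CAConfig n := fun y => if (σ : ℤ) ∣ y then 1 else 0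
  have hpow : ∀ t : ℕ, (linStep (0 : ZMod n) 1 ^ t) ξ = fun y => ξ (y - t) := by
    intro t
    induction t with
    | zero => funext y; simp
    | succ t ih =>
      rw [pow_succ', Module.End.mul_apply, ih]
      funext y
      simp only [linStep_apply, one_mul, zero_mul, add_zero]
      congr 1
      push_cast
      ring
  have hξ : ∀ y z : ℤ, ((σ : ℤ) ∣ y ↔ (σ : ℤ) ∣ z) → ξ y = ξ z := by
    intro y z h
    simp only [ξ, h]
  have hξ0 : ∀ y : ℤ, ξ y = 1 → (σ : ℤ) ∣ y := by
    intro y h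
    by_contra hy
    simp [ξ, hy] at h
  have h1 : ξ 0 = 1 := by simp [ξ]
  have hper : ∀ x : ℤ, ξ (x + σ) = ξ x := fun x => hξ _ _ (by simp)
  refine ⟨0, 1, ξ, ⟨σ, hσ, ?_⟩, ?_, hper, ?_⟩
  · rw [hpow]
    funext y
    exact hξ _ _ (by simp)
  · intro t ht
    rw [hpow] at ht
    have := congrFun ht t
    rw [sub_self, h1] at this
    exact_mod_cast hξ0 _ this.symm
  · intro _ d hd
    have := hd 0
    rw [zero_add, h1] at this
    exact_mod_cast hξ0 _ this

theorem exists_pow_add_eq_pow {E : Type*} [CommRing E] [Finite E] {l : ℕ}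
    (hl : ∀ w : Eˣ, w ^ l = 1) (τ : E) : ∃ p, τ ^ (l + p) = τ ^ p := by
  obtain ⟨i, j, hij, h⟩ := Finite.exists_ne_map_eq_of_infinite (fun i : ℕ => τ ^ i)
  wlog hlt : i < j generalizing i j
  · exact this j i hij.symm h.symm (by omega)
  obtain ⟨d, rfl⟩ := Nat.exists_eq_add_of_lt hlt
  have hd : ∀ k, τ ^ (i + (d + 1) * k) = τ ^ i := by
    intro k
    induction k with
    | zero => rfl
    | succ k ih =>
      have h' : τ ^ i = τ ^ i * τ ^ (d + 1) := by
        rw [← pow_add]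
        exact h
      rw [mul_add, mul_one, ← add_assoc, pow_add, ih, ← h']
  obtain ⟨q, hq⟩ : ∃ q, q = (d + 1) * (i + 1) := ⟨_, rfl⟩
  have hqi : i ≤ q := by nlinarith
  have he : τ ^ q * τ ^ q = τ ^ q := by
    obtain ⟨r, hr⟩ := Nat.exists_eq_add_of_le hqi
    have h2 : q + q = (i + (d + 1) * (i + 1)) + r := by rw [← hq]; omega
    rw [← pow_add, h2, pow_add, hd, ← pow_add, ← hr]
  have hunit : (τ ^ q * τ + (1 - τ ^ q)) * (τ ^ q * τ ^ (q - 1) + (1 - τ ^ q)) = 1 := by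
    have h1 : τ * τ ^ (q - 1) = τ ^ q := by
      rw [← pow_succ']
      congr 1
      have : 0 < q := hq ▸ by positivity
      omega
    linear_combination (τ ^ (q - 1) * τ - τ - τ ^ (q - 1) + 2) * he + τ ^ q * h1
  have hw := hl (Units.mkOfMulEqOne _ _ hunit)
  have hw' : (τ ^ q * τ + (1 - τ ^ q)) ^ l = 1 := by
    have := congrArg (fun u : Eˣ => (u : E)) hw
    simpa using this
  have hk : ∀ k, τ ^ q * (τ ^ q * τ + (1 - τ ^ q)) ^ k = τ ^ q * τ ^ k := by
    intro k
    induction k with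
    | zero => simp
    | succ k ih =>
      rw [pow_succ, ← mul_assoc, ih, pow_succ]
      linear_combination (τ ^ (k + 1) - τ ^ k) * he
  refine ⟨q, ?_⟩
  rw [add_comm, pow_add, ← hk, hw', mul_one]

theorem exists_uniform_pow_add_eq_pow {E : Type*} [CommRing E] [Finite E] {l : ℕ}
    (hl : ∀ w : Eˣ, w ^ l = 1) : ∃ p, ∀ τ : E, τ ^ (l + p) = τ ^ p := by
  choose p hp using exists_pow_add_eq_pow hl
  obtain ⟨B, hB⟩ := (Set.finite_range p).bddAbove
  refine ⟨B, fun τ => ?_⟩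
  obtain ⟨r, hr⟩ := Nat.exists_eq_add_of_le (hB ⟨τ, rfl⟩)
  rw [hr, ← add_assoc, pow_add, hp, ← pow_add]

theorem periodsDivide_of_fourier {σ n N l : ℕ} (hσ : 0 < σ) (hN : n ∣ N)
    (hcast : ∀ z : ZMod N, (σ : ZMod N) * z = 0 → ZMod.castHom hN (ZMod n) z = 0)
    {E : Type*} [CommRing E] [Finite E] [Algebra (ZMod N) E]
    (hinj : Function.Injective (algebraMap (ZMod N) E)) (ζ : Eˣ)
    (hζ : ∀ y : ℤ, ∑ k ∈ Finset.range σ, ((ζ ^ y : Eˣ) : E) ^ k =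
      if (σ : ℤ) ∣ y then (σ : E) else 0)
    (hl : ∀ w : Eˣ, w ^ l = 1) : PeriodsDivide σ n l := by
  intro a b ξ hξ t ht hfix
  obtain ⟨p, hp⟩ := exists_uniform_pow_add_eq_pow hl
  let g := ZMod.castHom hN (ZMod n)
  have hg : Function.Surjective g := ZMod.castHom_surjective hN
  obtain ⟨s, hs⟩ := hg.hasRightInverse
  let η : ℤ → E := fun y => algebraMap (ZMod N) E (s (ξ y))
  let α : E := algebraMap (ZMod N) E (s a)
  let β : E := algebraMap (ZMod N) E (s b)
  let χ : ℕ → ℤ → E := fun k y => ((ζ ^ y : Eˣ) : E) ^ k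
  have hχ : ∀ k, linStep α β (χ k) = (β * ((ζ ^ (-1 : ℤ) : Eˣ) : E) ^ k + α) • χ k := by
    intro k
    funext y
    simp only [linStep_apply, χ, Pi.smul_apply, smul_eq_mul, sub_eq_add_neg, zpow_add,
      Units.val_mul, mul_pow]
    ring
  have hχpow : ∀ k m, (linStep α β ^ m) (χ k) =
      (β * ((ζ ^ (-1 : ℤ) : Eˣ) : E) ^ k + α) ^ m • χ k := by
    intro k m
    induction m with
    | zero => simp
    | succ m ih => rw [pow_succ', Module.End.mul_apply, ih, map_smul, hχ, smul_smul, pow_succ]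
  have hηmod : ∀ (q y : ℤ), η (y + σ * q) = η y := by
    intro q y
    have hs' : ∀ y, η (y + σ) = η y := fun y => by simp only [η, hξ]
    have := (show Function.Periodic η (σ : ℤ) from hs').int_mul q y
    rwa [mul_comm] at this
  have hη : (σ : E) • η =
      ∑ k ∈ Finset.range σ, (∑ j ∈ Finset.range σ, η j * ((ζ ^ (-(j : ℤ)) : Eˣ) : E) ^ k) • χ k := by
    funext y
    rw [Finset.sum_apply]
    simp only [Pi.smul_apply, smul_eq_mul, χ, Finset.sum_mul]
    rw [Finset.sum_comm]
    have h1 : ∀ j ∈ Finset.range σ, ∑ k ∈ Finset.range σ,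
        η j * ((ζ ^ (-(j : ℤ)) : Eˣ) : E) ^ k * ((ζ ^ y : Eˣ) : E) ^ k =
        if j = (y % σ).toNat then σ * η y else 0 := by
      intro j hj
      have h2 : ∀ k ∈ Finset.range σ,
          η j * ((ζ ^ (-(j : ℤ)) : Eˣ) : E) ^ k * ((ζ ^ y : Eˣ) : E) ^ k =
          η j * ((ζ ^ (y - j) : Eˣ) : E) ^ k := by
        intro k _
        rw [sub_eq_neg_add, zpow_add, Units.val_mul, mul_pow, mul_assoc]
      rw [Finset.sum_congr rfl h2, ← Finset.mul_sum, hζ]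
      have hσ' : (0 : ℤ) < σ := by exact_mod_cast hσ
      have hm0 := Int.emod_nonneg y hσ'.ne'
      have hm1 := Int.emod_lt_of_pos y hσ'
      have hj' := Finset.mem_range.1 hj
      have hiff : (σ : ℤ) ∣ y - j ↔ j = (y % σ).toNat := by
        have hjmod : (j : ℤ) % σ = j := Int.emod_eq_of_lt (by positivity) (by exact_mod_cast hj')
        rw [← Int.modEq_iff_dvd, Int.ModEq, hjmod]
        omega
      by_cases hjy : (σ : ℤ) ∣ y - j
      · rw [if_pos hjy, if_pos (hiff.1 hjy)]
        obtain ⟨q, hq⟩ := hjy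
        have hy : y = j + σ * q := by linarith
        rw [hy, hηmod, mul_comm]
      · rw [if_neg hjy, if_neg (mt hiff.2 hjy), mul_zero]
    rw [Finset.sum_congr rfl h1, Finset.sum_ite_eq']
    have hσ' : (0 : ℤ) < σ := by exact_mod_cast hσ
    have hm0 := Int.emod_nonneg y hσ'.ne'
    have hm1 := Int.emod_lt_of_pos y hσ'
    rw [if_pos (Finset.mem_range.2 (by omega))]
  have hηpow : (linStep α β ^ (l + p)) ((σ : E) • η) = (linStep α β ^ p) ((σ : E) • η) := by
    rw [hη, map_sum, map_sum]
    refine Finset.sum_congr rfl fun k _ => ?_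
    rw [map_smul, map_smul, hχpow, hχpow, hp]
  have hlift : ∀ m, (linStep α β ^ m) ((σ : E) • η) =
      fun y => algebraMap (ZMod N) E (σ * (linStep (s a) (s b) ^ m) (s ∘ ξ) y) := by
    intro m
    have h1 := comp_linStep_pow (algebraMap (ZMod N) E) (s a) (s b) m (s ∘ ξ)
    have h2 : (algebraMap (ZMod N) E) ∘ (s ∘ ξ) = η := rfl
    rw [h2] at h1
    rw [map_smul, ← h1]
    funext y
    simp
  have hred : ∀ m, (linStep a b ^ m) ξ = g ∘ (linStep (s a) (s b) ^ m) (s ∘ ξ) := by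
    intro m
    rw [comp_linStep_pow, hs, hs]
    congr 1
    funext y
    exact (hs _).symm
  have hmain : (linStep a b ^ (l + p)) ξ = (linStep a b ^ p) ξ := by
    rw [hred, hred]
    funext y
    have h1 := congrFun ((hlift (l + p)).symm.trans (hηpow.trans (hlift p))) y
    have h2 := hinj h1
    have h3 := hcast _ ((mul_sub _ _ _).trans (sub_eq_zero.2 h2))
    rw [map_sub, sub_eq_zero] at h3
    exact h3
  have htp : (linStep a b ^ (t * p)) ξ = ξ := pow_mul_fixed hfix p
  obtain ⟨r, hr⟩ := Nat.exists_eq_add_of_le (Nat.le_mul_of_pos_left p ht)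
  calc (linStep a b ^ l) ξ = (linStep a b ^ l) ((linStep a b ^ (t * p)) ξ) := by rw [htp]
    _ = (linStep a b ^ r) ((linStep a b ^ (l + p)) ξ) := by
      rw [← Module.End.mul_apply, ← Module.End.mul_apply, ← pow_add, ← pow_add, hr]
      congr 2
      ring
    _ = (linStep a b ^ (t * p)) ξ := by
      rw [hmain, ← Module.End.mul_apply, ← pow_add, hr]
      congr 2
      ring
    _ = ξ := htp

theorem castHom_eq_zero_of_mul_eq_zero {σ n : ℕ} (hσ : 0 < σ) (z : ZMod (σ * n))
    (h : (σ : ZMod (σ * n)) * z = 0) :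
    ZMod.castHom (Dvd.intro_left σ rfl) (ZMod n) z = 0 := by
  obtain ⟨k, rfl⟩ := ZMod.intCast_surjective z
  rw [map_intCast, ZMod.intCast_zmod_eq_zero_iff_dvd]
  have h' : ((σ * k : ℤ) : ZMod (σ * n)) = 0 := by
    push_cast
    exact h
  rw [ZMod.intCast_zmod_eq_zero_iff_dvd] at h'
  push_cast at h'
  exact Int.dvd_of_mul_dvd_mul_left (by positivity) h'

instance finite_quadraticAlgebra {R : Type*} [Finite R] (a b : R) :
    Finite (QuadraticAlgebra R a b) :=
  Finite.of_equiv _ (QuadraticAlgebra.equivProd a b).symm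

/-- A ring homomorphism on coefficients extended to quadratic algebras. -/
def quadraticMap {R S : Type*} [CommRing R] [CommRing S] (g : R →+* S) {a b : R} {a' b' : S}
    (ha : g a = a') (hb : g b = b') : QuadraticAlgebra R a b →+* QuadraticAlgebra S a' b' where
  toFun z := ⟨g z.re, g z.im⟩
  map_zero' := by ext <;> simp
  map_one' := by ext <;> simp [QuadraticAlgebra.re_one, QuadraticAlgebra.im_one]
  map_add' z w := by ext <;> simp
  map_mul' z w := by
    subst ha hb
    ext <;> simp

theorem exponent_units_quadraticAlgebra_mul {m n : ℕ} (h : m.Coprime n) {a b : ZMod (m * n)}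
    {a₁ b₁ : ZMod m} {a₂ b₂ : ZMod n} (ha : ZMod.chineseRemainder h a = (a₁, a₂))
    (hb : ZMod.chineseRemainder h b = (b₁, b₂)) :
    Monoid.exponent (QuadraticAlgebra (ZMod (m * n)) a b)ˣ =
      Nat.lcm (Monoid.exponent (QuadraticAlgebra (ZMod m) a₁ b₁)ˣ)
        (Monoid.exponent (QuadraticAlgebra (ZMod n) a₂ b₂)ˣ) := by
  let e := ZMod.chineseRemainder h
  let g₁ : ZMod (m * n) →+* ZMod m := (RingHom.fst _ _).comp e.toRingHom
  let g₂ : ZMod (m * n) →+* ZMod n := (RingHom.snd _ _).comp e.toRingHom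
  let F := (quadraticMap g₁ (congrArg Prod.fst ha) (congrArg Prod.fst hb)).prod
    (quadraticMap g₂ (congrArg Prod.snd ha) (congrArg Prod.snd hb))
  have hF : Function.Bijective F := by
    constructor
    · intro z w hzw
      have h1 := congrArg Prod.fst hzw
      have h2 := congrArg Prod.snd hzw
      refine QuadraticAlgebra.ext (e.injective (Prod.ext ?_ ?_)) (e.injective (Prod.ext ?_ ?_))
      · exact congrArg QuadraticAlgebra.re h1
      · exact congrArg QuadraticAlgebra.re h2
      · exact congrArg QuadraticAlgebra.im h1
      · exact congrArg QuadraticAlgebra.im h2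
    · rintro ⟨z, w⟩
      refine ⟨⟨e.symm (z.re, w.re), e.symm (z.im, w.im)⟩, Prod.ext ?_ ?_⟩
      · refine QuadraticAlgebra.ext ?_ ?_
        · exact congrArg Prod.fst (e.apply_symm_apply (z.re, w.re))
        · exact congrArg Prod.fst (e.apply_symm_apply (z.im, w.im))
      · refine QuadraticAlgebra.ext ?_ ?_
        · exact congrArg Prod.snd (e.apply_symm_apply (z.re, w.re))
        · exact congrArg Prod.snd (e.apply_symm_apply (z.im, w.im))
  rw [Monoid.exponent_eq_of_mulEquiv (Units.mapEquiv (RingEquiv.ofBijective F hF).toMulEquiv),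
    Monoid.exponent_eq_of_mulEquiv MulEquiv.prodUnits, Monoid.exponent_prod]
  rfl

theorem lambdaThree_mul {m n : ℕ} (h : m.Coprime n) :
    lambdaThree (m * n) = (lambdaThree m).lcm (lambdaThree n) :=
  exponent_units_quadraticAlgebra_mul h (by rw [map_neg, map_one]; rfl)
    (by rw [map_neg, map_one]; rfl)

theorem lambdaFour_mul {m n : ℕ} (h : m.Coprime n) :
    lambdaFour (m * n) = (lambdaFour m).lcm (lambdaFour n) :=
  exponent_units_quadraticAlgebra_mul h (by rw [map_neg, map_one]; rfl) (map_zero _)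

theorem lambdaTwo_pos (n : ℕ) [NeZero n] : 0 < lambdaTwo n :=
  Nat.pos_of_ne_zero Monoid.exponent_ne_zero_of_finite

theorem lambdaThree_pos (n : ℕ) [NeZero n] : 0 < lambdaThree n :=
  Nat.pos_of_ne_zero Monoid.exponent_ne_zero_of_finite

theorem lambdaFour_pos (n : ℕ) [NeZero n] : 0 < lambdaFour n :=
  Nat.pos_of_ne_zero Monoid.exponent_ne_zero_of_finite

theorem pow_add_dvd_pow_sub_one {A : Type*} [CommRing A] {p i : ℕ} (hi : 1 ≤ i) {u : A}
    (h : (p : A) ^ i ∣ u - 1) (k : ℕ) : (p : A) ^ (i + k) ∣ u ^ p ^ k - 1 := by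
  induction k with
  | zero => simpa using h
  | succ k ih =>
    rw [pow_succ p k, pow_mul, ← add_assoc, pow_succ (p : A) (i + k)]
    set v := u ^ p ^ k
    rw [← mul_geom_sum v p]
    refine mul_dvd_mul ih ?_
    have hp : (p : A) ∣ v - 1 := (dvd_pow_self _ (by omega)).trans ih
    have h1 : ∑ j ∈ Finset.range p, v ^ j = ∑ j ∈ Finset.range p, (v ^ j - 1) + p := by
      simp
    rw [h1]
    refine dvd_add (Finset.dvd_sum fun j _ => hp.trans ?_) dvd_rfl
    simpa using sub_dvd_pow_sub_pow v 1 j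

theorem natCast_dvd_of_quadraticMap_eq_zero {q N : ℕ} [NeZero N] (hq : q ∣ N) {a b : ZMod N}
    {a' b' : ZMod q} (ha : ZMod.castHom hq (ZMod q) a = a') (hb : ZMod.castHom hq (ZMod q) b = b')
    {z : QuadraticAlgebra (ZMod N) a b} (h : quadraticMap (ZMod.castHom hq (ZMod q)) ha hb z = 0) :
    (q : QuadraticAlgebra (ZMod N) a b) ∣ z := by
  have key : ∀ r : ZMod N, ZMod.castHom hq (ZMod q) r = 0 → ∃ s : ZMod N, r = q * s := by
    intro r hr
    obtain ⟨k, rfl⟩ := ZMod.natCast_zmod_surjective r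
    rw [map_natCast, ZMod.natCast_eq_zero_iff] at hr
    obtain ⟨s, rfl⟩ := hr
    exact ⟨s, by push_cast; rfl⟩
  obtain ⟨s, hs⟩ := key z.re (congrArg QuadraticAlgebra.re h)
  obtain ⟨t, ht⟩ := key z.im (congrArg QuadraticAlgebra.im h)
  exact ⟨⟨s, t⟩, by ext <;> simp [hs, ht]⟩

theorem natCast_dvd_eisenstein_pow_sub_one {q e N : ℕ} [NeZero N] (hq : q ∣ N)
    (he : ∀ z : EisensteinMod q, IsUnit z → z ^ e = 1) (w : (EisensteinMod N)ˣ) :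
    (q : EisensteinMod N) ∣ (w : EisensteinMod N) ^ e - 1 := by
  refine natCast_dvd_of_quadraticMap_eq_zero hq (a' := -1) (b' := -1)
    (by rw [map_neg, map_one]) (by rw [map_neg, map_one]) ?_
  rw [map_sub, map_pow, he _ (w.isUnit.map _), map_one, sub_self]

theorem eisensteinMod_two_pow_three {z : EisensteinMod 2} (hz : IsUnit z) : z ^ 3 = 1 := by
  have h : ∀ a b : ZMod 2, a * a + -1 * a * b - -1 * b * b ≠ 0 →
      (⟨a, b⟩ : EisensteinMod 2) ^ 3 = 1 := by decide +kernel
  exact h z.re z.im (QuadraticAlgebra.isUnit_iff_norm_isUnit.1 hz).ne_zero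

theorem eisensteinMod_three_pow_six {z : EisensteinMod 3} (hz : IsUnit z) : z ^ 6 = 1 := by
  have h : ∀ a b : ZMod 3, a * a + -1 * a * b - -1 * b * b ≠ 0 →
      (⟨a, b⟩ : EisensteinMod 3) ^ 6 = 1 := by decide +kernel
  exact h z.re z.im (QuadraticAlgebra.isUnit_iff_norm_isUnit.1 hz).ne_zero

theorem eisensteinMod_nine_pow_six {z : EisensteinMod 9} (hz : IsUnit z) : z ^ 6 = 1 := by
  have h : ∀ a b : ZMod 9, (a * a + -1 * a * b - -1 * b * b) ^ 6 = 1 →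
      (⟨a, b⟩ : EisensteinMod 9) ^ 6 = 1 := by decide +kernel
  have h' : ∀ u : ZMod 9, IsUnit u → u ^ 6 = 1 := by
    rintro _ ⟨u, rfl⟩
    have := ZMod.pow_totient u
    rw [show Nat.totient 9 = 6 by decide] at this
    rw [← Units.val_pow_eq_pow_val, this, Units.val_one]
  exact h z.re z.im (h' _ (QuadraticAlgebra.isUnit_iff_norm_isUnit.1 hz))

theorem natCast_pow_eq_zero (p k : ℕ) (a b : ZMod (p ^ k)) :
    (p : QuadraticAlgebra (ZMod (p ^ k)) a b) ^ k = 0 := by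
  rw [← Nat.cast_pow]
  ext
  · rw [QuadraticAlgebra.re_natCast, ZMod.natCast_self, QuadraticAlgebra.re_zero]
  · rw [QuadraticAlgebra.im_natCast, QuadraticAlgebra.im_zero]

theorem lambdaThree_two_pow_dvd (j : ℕ) : lambdaThree (2 ^ (j + 1)) ∣ 3 * 2 ^ j := by
  refine Monoid.exponent_dvd_of_forall_pow_eq_one fun w => Units.ext ?_
  have h1 := natCast_dvd_eisenstein_pow_sub_one (dvd_pow_self 2 j.succ_ne_zero)
    (fun z hz => eisensteinMod_two_pow_three hz) w
  have h2 := pow_add_dvd_pow_sub_one (A := EisensteinMod (2 ^ (j + 1))) (p := 2) (i := 1) le_rfl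
    (by rw [pow_one]; exact h1) j
  have hadd : 1 + j = j + 1 := add_comm _ _
  rw [hadd, natCast_pow_eq_zero, zero_dvd_iff, sub_eq_zero, ← pow_mul] at h2
  simpa using h2

theorem lambdaThree_three_dvd : lambdaThree 3 ∣ 6 :=
  Monoid.exponent_dvd_of_forall_pow_eq_one fun w =>
    Units.ext (by simpa using eisensteinMod_three_pow_six w.isUnit)

theorem lambdaThree_three_pow_dvd (k : ℕ) : lambdaThree (3 ^ (k + 2)) ∣ 2 * 3 ^ (k + 1) := by
  refine Monoid.exponent_dvd_of_forall_pow_eq_one fun w => Units.ext ?_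
  have h1 := natCast_dvd_eisenstein_pow_sub_one (q := 9) (N := 3 ^ (k + 2))
    ⟨3 ^ k, by rw [pow_add]; ring⟩ (fun z hz => eisensteinMod_nine_pow_six hz) w
  have h2 := pow_add_dvd_pow_sub_one (A := EisensteinMod (3 ^ (k + 2))) (p := 3) (i := 2) (by norm_num)
    (by rw [← Nat.cast_pow]; exact h1) k
  have hadd : 2 + k = k + 2 := add_comm _ _
  rw [hadd, natCast_pow_eq_zero, zero_dvd_iff, sub_eq_zero, ← pow_mul] at h2
  rw [show 2 * 3 ^ (k + 1) = 6 * 3 ^ k by ring]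
  simpa using h2

/-- The primitive cube root of unity `ω` in the Eisenstein integers modulo `n`. -/
def eisensteinOmega (n : ℕ) : (EisensteinMod n)ˣ where
  val := ⟨0, 1⟩
  inv := ⟨-1, -1⟩
  val_inv := by ext <;> simp [QuadraticAlgebra.re_one, QuadraticAlgebra.im_one]
  inv_val := by ext <;> simp [QuadraticAlgebra.re_one, QuadraticAlgebra.im_one]

/-- The primitive sixth root of unity `1 + ω` in the Eisenstein integers modulo `n`. -/
def eisensteinZeta (n : ℕ) : (EisensteinMod n)ˣ where
  val := ⟨1, 1⟩
  inv := ⟨0, -1⟩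
  val_inv := by ext <;> simp [QuadraticAlgebra.re_one, QuadraticAlgebra.im_one]
  inv_val := by ext <;> simp [QuadraticAlgebra.re_one, QuadraticAlgebra.im_one]

/-- The imaginary unit in the Gaussian integers modulo `n`. -/
def gaussianI (n : ℕ) : (GaussianMod n)ˣ where
  val := ⟨0, 1⟩
  inv := ⟨0, -1⟩
  val_inv := by ext <;> simp [QuadraticAlgebra.re_one, QuadraticAlgebra.im_one]
  inv_val := by ext <;> simp [QuadraticAlgebra.re_one, QuadraticAlgebra.im_one]

theorem ZMod.neg_one_ne_one_of_three_le {n : ℕ} (hn : 3 ≤ n) : (-1 : ZMod n) ≠ 1 := by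
  have : Fact (2 < n) := ⟨hn⟩
  exact ZMod.neg_one_ne_one

theorem eisensteinOmega_pow_three (n : ℕ) : eisensteinOmega n ^ 3 = 1 := by
  refine Units.ext ?_
  ext <;> simp [eisensteinOmega, pow_succ, QuadraticAlgebra.re_one, QuadraticAlgebra.im_one]

theorem orderOf_eisensteinOmega {n : ℕ} (hn : 1 < n) : orderOf (eisensteinOmega n) = 3 := by
  have : Fact (1 < n) := ⟨hn⟩
  refine orderOf_eq_prime (eisensteinOmega_pow_three n) fun h => ?_
  have := congrArg (fun u : (EisensteinMod n)ˣ => u.val.im) h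
  simp [eisensteinOmega, QuadraticAlgebra.im_one] at this

theorem eisensteinZeta_sq (n : ℕ) : eisensteinZeta n ^ 2 = eisensteinOmega n := by
  refine Units.ext ?_
  ext <;> simp [eisensteinZeta, eisensteinOmega, pow_succ]

theorem eisensteinZeta_pow_three (n : ℕ) : eisensteinZeta n ^ 3 = -1 := by
  refine Units.ext ?_
  ext <;> simp [eisensteinZeta, pow_succ, QuadraticAlgebra.re_one, QuadraticAlgebra.im_one]

theorem eisensteinZeta_pow_six (n : ℕ) : eisensteinZeta n ^ 6 = 1 := by
  rw [show 6 = 3 * 2 by norm_num, pow_mul, eisensteinZeta_pow_three, neg_one_sq]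

theorem Nat.Prime.eq_two_or_three_of_dvd {p j : ℕ} (hp : p.Prime) (h : p ∣ 3 * 2 ^ j) :
    p = 2 ∨ p = 3 := by
  rcases hp.dvd_mul.1 h with h | h
  · exact Or.inr ((Nat.prime_dvd_prime_iff_eq hp Nat.prime_three).1 h)
  · exact Or.inl ((Nat.prime_dvd_prime_iff_eq hp Nat.prime_two).1 (hp.dvd_of_dvd_pow h))

theorem orderOf_eisensteinZeta {n : ℕ} (hn : 3 ≤ n) : orderOf (eisensteinZeta n) = 6 := by
  have : Fact (1 < n) := ⟨by omega⟩
  refine orderOf_eq_of_pow_and_pow_div_prime (by norm_num) (eisensteinZeta_pow_six n) ?_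
  intro p hp hp6
  rcases Nat.Prime.eq_two_or_three_of_dvd (j := 1) hp hp6 with rfl | rfl
  · rw [show 6 / 2 = 3 by norm_num, eisensteinZeta_pow_three]
    intro h
    have := congrArg (fun u : (EisensteinMod n)ˣ => u.val.re) h
    exact ZMod.neg_one_ne_one_of_three_le hn (by simpa [QuadraticAlgebra.re_one] using this)
  · rw [show 6 / 3 = 2 by norm_num, eisensteinZeta_sq]
    intro h
    have := congrArg (fun u : (EisensteinMod n)ˣ => u.val.im) h
    simp [eisensteinOmega, QuadraticAlgebra.im_one] at this

theorem gaussianI_sq (n : ℕ) : gaussianI n ^ 2 = -1 := by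
  refine Units.ext ?_
  ext <;> simp [gaussianI, pow_succ, QuadraticAlgebra.re_one, QuadraticAlgebra.im_one]

theorem gaussianI_pow_four (n : ℕ) : gaussianI n ^ 4 = 1 := by
  rw [show 4 = 2 * 2 by norm_num, pow_mul, gaussianI_sq, neg_one_sq]

theorem orderOf_gaussianI {n : ℕ} (hn : 3 ≤ n) : orderOf (gaussianI n) = 4 := by
  refine orderOf_eq_prime_pow (p := 2) (n := 1) ?_ (gaussianI_pow_four n)
  rw [pow_one, gaussianI_sq]
  intro h
  have := congrArg (fun u : (GaussianMod n)ˣ => u.val.re) h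
  exact ZMod.neg_one_ne_one_of_three_le hn (by simpa [QuadraticAlgebra.re_one] using this)

theorem three_dvd_lambdaThree {n : ℕ} (hn : 1 < n) : 3 ∣ lambdaThree n :=
  orderOf_eisensteinOmega hn ▸ Monoid.order_dvd_exponent _

theorem six_dvd_lambdaThree {n : ℕ} (hn : 3 ≤ n) : 6 ∣ lambdaThree n :=
  orderOf_eisensteinZeta hn ▸ Monoid.order_dvd_exponent _

theorem four_dvd_lambdaFour {n : ℕ} (hn : 3 ≤ n) : 4 ∣ lambdaFour n :=
  orderOf_gaussianI hn ▸ Monoid.order_dvd_exponent _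

theorem exists_one_add_two_I_pow (R : Type*) [CommRing R] (j : ℕ) :
    ∃ r s : R, (⟨1, 2⟩ : QuadraticAlgebra R (-1) 0) ^ 2 ^ (j + 1) =
      ⟨1 + 2 ^ (j + 2) * (1 + 2 * r), 2 ^ (j + 2) * (1 + 2 * s)⟩ := by
  induction j with
  | zero =>
    refine ⟨-1, 0, ?_⟩
    ext <;> simp [pow_succ] <;> ring
  | succ j ih =>
    obtain ⟨r, s, h⟩ := ih
    rw [pow_succ, pow_mul, h]
    refine ⟨r + 2 ^ j * ((1 + 2 * r) ^ 2 - (1 + 2 * s) ^ 2),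
      s + 2 ^ (j + 1) * (1 + 2 * r) * (1 + 2 * s), ?_⟩
    rw [pow_two]
    ext
    · simp only [QuadraticAlgebra.re_mul]
      ring
    · simp only [QuadraticAlgebra.im_mul]
      ring

theorem ZMod.two_pow_eq_zero (k : ℕ) : (2 : ZMod (2 ^ k)) ^ k = 0 := by
  exact_mod_cast ZMod.natCast_self (2 ^ k)

theorem ZMod.two_pow_mul_odd_ne_zero (k : ℕ) (r : ZMod (2 ^ (k + 1))) :
    2 ^ k * (1 + 2 * r) ≠ 0 := by
  intro h
  have h1 : (2 : ZMod (2 ^ (k + 1))) ^ k = 0 := by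
    linear_combination h - r * ZMod.two_pow_eq_zero (k + 1)
  have h2 : ((2 ^ k : ℕ) : ZMod (2 ^ (k + 1))) = 0 := by exact_mod_cast h1
  rw [ZMod.natCast_eq_zero_iff] at h2
  exact absurd (Nat.le_of_dvd (by positivity) h2) (by rw [pow_succ]; have := Nat.two_pow_pos k; omega)

theorem two_pow_dvd_lambdaFour (k : ℕ) : 2 ^ (k + 2) ∣ lambdaFour (2 ^ (k + 3)) := by
  have hunit : IsUnit (⟨1, 2⟩ : GaussianMod (2 ^ (k + 3))) := by
    rw [QuadraticAlgebra.isUnit_iff_norm_isUnit, QuadraticAlgebra.norm_def]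
    have := (ZMod.isUnit_iff_coprime 5 (2 ^ (k + 3))).2 (Nat.Coprime.pow_right _ (by norm_num))
    convert this using 1
    push_cast
    ring
  obtain ⟨u, hu⟩ := hunit
  have h : orderOf u = 2 ^ (k + 2) := by
    refine orderOf_eq_prime_pow ?_ ?_
    · intro h
      obtain ⟨r, s, hrs⟩ := exists_one_add_two_I_pow (ZMod (2 ^ (k + 3))) k
      rw [Units.ext_iff, Units.val_pow_eq_pow_val, hu, hrs] at h
      exact ZMod.two_pow_mul_odd_ne_zero (k + 2) s (congrArg QuadraticAlgebra.im h)
    · obtain ⟨r, s, hrs⟩ := exists_one_add_two_I_pow (ZMod (2 ^ (k + 3))) (k + 1)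
      rw [Units.ext_iff, Units.val_pow_eq_pow_val, hu, hrs]
      have h0 : (2 : ZMod (2 ^ (k + 3))) ^ (k + 1 + 2) = 0 := ZMod.two_pow_eq_zero (k + 3)
      rw [h0]
      ext <;> simp [QuadraticAlgebra.re_one, QuadraticAlgebra.im_one]
  exact h ▸ Monoid.order_dvd_exponent u

/-- The group ring over `ZMod n` of the cyclic group of order two. -/
abbrev SplitMod (n : ℕ) : Type := QuadraticAlgebra (ZMod n) 1 0

/-- The generator of order two in `SplitMod n`. -/
def splitX (n : ℕ) : (SplitMod n)ˣ where
  val := ⟨0, 1⟩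
  inv := ⟨0, 1⟩
  val_inv := by ext <;> simp [QuadraticAlgebra.re_one, QuadraticAlgebra.im_one]
  inv_val := by ext <;> simp [QuadraticAlgebra.re_one, QuadraticAlgebra.im_one]

theorem splitX_sq (n : ℕ) : splitX n ^ 2 = 1 := by
  refine Units.ext ?_
  ext <;> simp [splitX, pow_two, QuadraticAlgebra.re_one, QuadraticAlgebra.im_one]

theorem orderOf_splitX {n : ℕ} (hn : 1 < n) : orderOf (splitX n) = 2 := by
  have : Fact (1 < n) := ⟨hn⟩
  refine orderOf_eq_prime (splitX_sq n) fun h => ?_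
  have := congrArg (fun u : (SplitMod n)ˣ => u.val.im) h
  simp [splitX, QuadraticAlgebra.im_one] at this

theorem hasPeriodMultiple_two {n : ℕ} (hn : 1 < n) : HasPeriodMultiple 2 n (lambdaTwo (2 * n)) := by
  have : NeZero n := ⟨by omega⟩
  have : Fact (1 < n) := ⟨hn⟩
  obtain ⟨g, hg⟩ := Monoid.exists_orderOf_eq_exponent
    (Monoid.ExponentExists.of_finite (G := (ZMod (2 * n))ˣ))
  obtain ⟨z, hz⟩ := ZMod.natCast_zmod_surjective (g : ZMod (2 * n))
  have hodd : Odd z := by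
    have h := (ZMod.isUnit_iff_coprime z (2 * n)).1 (hz ▸ g.isUnit)
    exact Nat.coprime_two_right.1 (Nat.Coprime.coprime_mul_right_right h)
  obtain ⟨c, rfl⟩ := hodd
  let T₀ : SplitMod n := ⟨c + 1, -c⟩
  have hpow : ∀ t : ℕ, ∃ r : ℤ, (2 * c + 1 : ℤ) ^ t = 2 * r + 1 ∧ T₀ ^ t = ⟨r + 1, -r⟩ := by
    intro t
    induction t with
    | zero => exact ⟨0, by simp, by ext <;> simp [QuadraticAlgebra.re_one, QuadraticAlgebra.im_one]⟩
    | succ t ih =>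
      obtain ⟨r, h1, h2⟩ := ih
      refine ⟨2 * c * r + c + r, by rw [pow_succ, h1]; ring, ?_⟩
      rw [pow_succ, h2]
      ext
      · simp only [T₀, QuadraticAlgebra.re_mul]
        push_cast
        ring
      · simp only [T₀, QuadraticAlgebra.im_mul]
        push_cast
        ring
  have hiff : ∀ t : ℕ, T₀ ^ t = 1 ↔ g ^ t = 1 := by
    intro t
    obtain ⟨r, h1, h2⟩ := hpow t
    have hr : T₀ ^ t = 1 ↔ (n : ℤ) ∣ r := by
      rw [h2, ← ZMod.intCast_zmod_eq_zero_iff_dvd, QuadraticAlgebra.ext_iff]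
      simp [QuadraticAlgebra.re_one, QuadraticAlgebra.im_one]
    rw [hr, Units.ext_iff, Units.val_pow_eq_pow_val, ← hz, Units.val_one]
    have h3 : (((2 * c + 1 : ℕ) : ZMod (2 * n))) ^ t = ((2 * r : ℤ) : ZMod (2 * n)) + 1 := by
      have := congrArg (Int.cast : ℤ → ZMod (2 * n)) h1
      push_cast at this ⊢
      exact this
    rw [h3, add_eq_right, ZMod.intCast_zmod_eq_zero_iff_dvd]
    push_cast
    exact (mul_dvd_mul_iff_left two_ne_zero).symm
  have hT1 : T₀ ^ orderOf g = 1 := (hiff _).2 (pow_orderOf_eq_one g)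
  let T : (SplitMod n)ˣ := Units.ofPowEqOne T₀ (orderOf g) hT1 (orderOf_pos g).ne'
  refine hasPeriodMultiple_of_algebra (splitX n) (QuadraticAlgebra.reₗ _ _) ?_ (splitX_sq n)
    (fun hn => (orderOf_splitX hn).symm.dvd) (c + 1) (-c) T ?_ ?_
  · intro w hw
    have h0 := hw 0
    have h1 := hw 1
    ext
    · simpa using h0
    · simpa [splitX] using h1
  · ext <;> simp [T, T₀, splitX, QuadraticAlgebra.re_one, QuadraticAlgebra.im_one]
  · refine (Eq.dvd hg.symm).trans (orderOf_dvd_of_pow_eq_one ((hiff _).1 ?_))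
    exact congrArg Units.val (pow_orderOf_eq_one T)

theorem hasPeriodMultiple_four {n : ℕ} (hn : 3 ≤ n) : HasPeriodMultiple 4 n (lambdaFour n) := by
  have : NeZero n := ⟨by omega⟩
  obtain ⟨T, hT⟩ := Monoid.exists_orderOf_eq_exponent
    (Monoid.ExponentExists.of_finite (G := (GaussianMod n)ˣ))
  refine hasPeriodMultiple_of_algebra (gaussianI n) (QuadraticAlgebra.reₗ _ _) ?_
    (gaussianI_pow_four n) (fun _ => (orderOf_gaussianI hn).symm.dvd) (T : GaussianMod n).re
    (T : GaussianMod n).im T ?_ hT.symm.dvd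
  · intro w hw
    have h0 := hw 0
    have h1 := hw 1
    ext
    · simpa using h0
    · simpa [gaussianI] using h1
  · ext <;> simp [gaussianI]

theorem hasPeriodMultiple_three (n : ℕ) [NeZero n] : HasPeriodMultiple 3 n (lambdaThree n) := by
  obtain ⟨T, hT⟩ := Monoid.exists_orderOf_eq_exponent
    (Monoid.ExponentExists.of_finite (G := (EisensteinMod n)ˣ))
  refine hasPeriodMultiple_of_algebra (eisensteinOmega n) (QuadraticAlgebra.reₗ _ _) ?_
    (eisensteinOmega_pow_three n) (fun hn => (orderOf_eisensteinOmega hn).symm.dvd)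
    (T : EisensteinMod n).re (T : EisensteinMod n).im T ?_ hT.symm.dvd
  · intro w hw
    have h0 := hw 0
    have h1 := hw 1
    ext
    · simpa using h0
    · simpa [eisensteinOmega] using h1
  · ext <;> simp [eisensteinOmega]

theorem hasPeriodMultiple_six {n : ℕ} [NeZero n] (hn : n ≠ 2) :
    HasPeriodMultiple 6 n (lambdaThree n) := by
  obtain ⟨T, hT⟩ := Monoid.exists_orderOf_eq_exponent
    (Monoid.ExponentExists.of_finite (G := (EisensteinMod n)ˣ))
  refine hasPeriodMultiple_of_algebra (eisensteinZeta n) (QuadraticAlgebra.reₗ _ _) ?_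
    (eisensteinZeta_pow_six n) (fun h => (orderOf_eisensteinZeta (by omega)).symm.dvd)
    ((T : EisensteinMod n).re - (T : EisensteinMod n).im) (T : EisensteinMod n).im T ?_ hT.symm.dvd
  · intro w hw
    have h0 := hw 0
    have h1 := hw 1
    have h0' : w.re = 0 := by simpa using h0
    ext
    · exact h0'
    · simpa [eisensteinZeta, h0'] using h1
  · ext <;> simp [eisensteinZeta]

instance finite_addMonoidAlgebra {R M : Type*} [Semiring R] [Finite R] [Finite M] :
    Finite (AddMonoidAlgebra R M) :=
  have : Finite (M →₀ R) := Finite.of_injective _ DFunLike.coe_injective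
  Finite.of_injective _ AddMonoidAlgebra.coeff_injective

theorem exists_two_sub_pow {A : Type*} [CommRing A] {x : A} (hx : x ^ 3 = 1) (k : ℕ) :
    ∃ w, (2 - x) ^ 3 ^ (k + 1) = 1 + 3 ^ (k + 1) * (2 + 3 * w) * (1 - x) ^ 2 := by
  induction k with
  | zero =>
    refine ⟨0, ?_⟩
    linear_combination -hx
  | succ k ih =>
    obtain ⟨w, hw⟩ := ih
    have hz : ((1 - x) ^ 2) ^ 2 = -3 * x * (1 - x) ^ 2 := by linear_combination -(1 - x) * hx
    rw [pow_succ 3 (k + 1), pow_mul, hw]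
    generalize (1 - x) ^ 2 = z at hz
    obtain ⟨c, hc⟩ : ∃ c, c = (3 : A) ^ (k + 1) * (2 + 3 * w) := ⟨_, rfl⟩
    refine ⟨w + (2 + 3 * w) * (-c * x + c ^ 2 * x ^ 2), ?_⟩
    have h1 : (3 : A) ^ (k + 1 + 1) * (2 + 3 * (w + (2 + 3 * w) * (-c * x + c ^ 2 * x ^ 2))) * z =
        3 * c * (1 - 3 * c * x + 3 * c ^ 2 * x ^ 2) * z := by
      linear_combination (-3 * z * (1 - 3 * c * x + 3 * c ^ 2 * x ^ 2)) * hc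
    rw [h1, ← hc]
    linear_combination (3 * c ^ 2 + c ^ 3 * (z - 3 * x)) * hz

theorem ZMod.two_mul_three_pow_ne_zero (k : ℕ) : (2 * 3 ^ k : ZMod (3 ^ (k + 1))) ≠ 0 := by
  intro h
  have h2 : ((2 * 3 ^ k : ℕ) : ZMod (3 ^ (k + 1))) = 0 := by exact_mod_cast h
  rw [ZMod.natCast_eq_zero_iff] at h2
  have h3 := Nat.le_of_dvd (by positivity) h2
  rw [pow_succ] at h3
  have : 0 < 3 ^ k := by positivity
  omega

theorem ZMod.three_le_three_pow (k : ℕ) : 3 ≤ 3 ^ (k + 1) := by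
  rw [pow_succ]
  have : 0 < 3 ^ k := by positivity
  omega

theorem exists_unit_sub_two {k : ℕ} {A : Type*} [CommRing A] [Algebra (ZMod (3 ^ (k + 1))) A]
    (φ : A →ₗ[ZMod (3 ^ (k + 1))] ZMod (3 ^ (k + 1))) {x : A} (hx : x ^ 3 = 1) (h0 : φ 1 = 1)
    (h1 : φ x = 0) (h2 : φ (x ^ 2) = 0) :
    ∃ T : Aˣ, (T : A) = x - 2 ∧ 2 * 3 ^ (k + 1) ∣ orderOf T := by
  have hne : (-1 : ZMod (3 ^ (k + 1))) ≠ 1 :=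
    ZMod.neg_one_ne_one_of_three_le (ZMod.three_le_three_pow k)
  have hchar : (3 : A) ^ (k + 1) = 0 := by
    have : ((3 ^ (k + 1) : ℕ) : ZMod (3 ^ (k + 1))) = 0 := ZMod.natCast_self _
    have := congrArg (algebraMap (ZMod (3 ^ (k + 1))) A) this
    rw [map_natCast, map_zero] at this
    exact_mod_cast this
  have hS : (2 - x) ^ 3 ^ (k + 1) = 1 := by
    obtain ⟨w, hw⟩ := exists_two_sub_pow hx k
    rw [hw, hchar, zero_mul, zero_mul, add_zero]
  let S : Aˣ := Units.ofPowEqOne (2 - x) (3 ^ (k + 1)) hS (by positivity)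
  have hSval : (S : A) = 2 - x := rfl
  have hSorder : orderOf S = 3 ^ (k + 1) := by
    refine orderOf_eq_prime_pow ?_ (Units.ext (by rw [Units.val_pow_eq_pow_val, hSval, hS]; rfl))
    intro h
    have h' : (2 - x) ^ 3 ^ k = 1 := by
      rw [← hSval, ← Units.val_pow_eq_pow_val, h, Units.val_one]
    cases k with
    | zero =>
      have h3 : x = 1 := by linear_combination -h'
      have h4 : (1 : ZMod (3 ^ (0 + 1))) = 0 := by rw [← h0, ← h1, h3]
      exact absurd h4 (by decide)
    | succ j =>
      obtain ⟨w, hw⟩ := exists_two_sub_pow hx j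
      have h3 : ((2 * 3 ^ (j + 1) : ℕ) : ZMod (3 ^ (j + 1 + 1))) • (1 - (2 : ZMod (3 ^ (j + 1 + 1))) •
          x + x ^ 2) = 0 := by
        rw [Algebra.smul_def, Algebra.smul_def, map_natCast, map_ofNat]
        push_cast
        linear_combination h' - hw - w * (1 - x) ^ 2 * hchar
      have h4 := congrArg φ h3
      rw [map_smul, map_add, map_sub, map_smul, h0, h1, h2, map_zero] at h4
      refine ZMod.two_mul_three_pow_ne_zero (j + 1) ?_
      simpa using h4
  refine ⟨-S, by rw [Units.val_neg, hSval]; ring, ?_⟩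
  have hpow := pow_orderOf_eq_one (-S)
  have h3 : 3 ^ (k + 1) ∣ orderOf (-S) := by
    have h4 : S ^ (orderOf (-S) * 2) = 1 := by
      rw [mul_comm, pow_mul, ← neg_sq, ← pow_mul, mul_comm, pow_mul, hpow, one_pow]
    have h5 := orderOf_dvd_of_pow_eq_one h4
    rw [hSorder] at h5
    exact Nat.Coprime.dvd_of_dvd_mul_right (Nat.Coprime.pow_left _ (by norm_num)) h5
  have heven : 2 ∣ orderOf (-S) := by
    by_contra hodd
    have hodd' : Odd (orderOf (-S)) := Nat.not_even_iff_odd.1 fun h => hodd h.two_dvd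
    have h5 : S ^ orderOf (-S) = 1 := by
      obtain ⟨r, hr⟩ := h3
      rw [hr, pow_mul, ← hSorder, pow_orderOf_eq_one, one_pow]
    rw [hodd'.neg_pow, h5] at hpow
    have h6 := congrArg (fun u : Aˣ => φ u) hpow
    simp only [Units.val_neg, Units.val_one, map_neg, h0] at h6
    exact hne h6
  exact Nat.Coprime.mul_dvd_of_dvd_of_dvd (Nat.Coprime.pow_right _ (by norm_num)) heven h3

/-- The group ring over `ZMod n` of the cyclic group of order three. -/
abbrev CubicMod (n : ℕ) : Type := AddMonoidAlgebra (ZMod n) (ZMod 3)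

/-- The generator of order three in `CubicMod n`. -/
noncomputable def cubicX (n : ℕ) : (CubicMod n)ˣ :=
  Units.ofPowEqOne (AddMonoidAlgebra.single 1 1) 3
    (by rw [AddMonoidAlgebra.single_pow, one_pow]; rfl) (by norm_num)

/-- The coefficient of the identity as a linear form on `CubicMod n`. -/
noncomputable def cubicCoeff (n : ℕ) : CubicMod n →ₗ[ZMod n] ZMod n :=
  Finsupp.lapply 0 ∘ₗ (AddMonoidAlgebra.coeffLinearEquiv (ZMod n)).toLinearMap

theorem cubicCoeff_pow_mul (n k : ℕ) (w : CubicMod n) :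
    cubicCoeff n ((cubicX n : CubicMod n) ^ k * w) = w.coeff (-k) := by
  change ((AddMonoidAlgebra.single (1 : ZMod 3) (1 : ZMod n)) ^ k * w).coeff 0 = _
  rw [AddMonoidAlgebra.single_pow, AddMonoidAlgebra.coeff_single_mul_apply]
  simp

theorem cubicCoeff_nondegenerate (n : ℕ) {w : CubicMod n}
    (hw : ∀ k : ℕ, cubicCoeff n ((cubicX n : CubicMod n) ^ k * w) = 0) : w = 0 := by
  refine AddMonoidAlgebra.ext (Finsupp.ext fun y => ?_)
  have := hw (-y).val
  rw [cubicCoeff_pow_mul, ZMod.natCast_zmod_val, neg_neg] at this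
  exact this

theorem cubicCoeff_one (n : ℕ) : cubicCoeff n 1 = 1 := by
  have := cubicCoeff_pow_mul n 0 1
  simpa [AddMonoidAlgebra.one_def] using this

theorem cubicCoeff_X (n : ℕ) : cubicCoeff n (cubicX n) = 0 := by
  have := cubicCoeff_pow_mul n 1 1
  rw [mul_one, pow_one] at this
  rw [this, AddMonoidAlgebra.one_def, AddMonoidAlgebra.coeff_single]
  exact Finsupp.single_eq_of_ne (by decide)

theorem cubicCoeff_X_sq (n : ℕ) : cubicCoeff n ((cubicX n : CubicMod n) ^ 2) = 0 := by
  have := cubicCoeff_pow_mul n 2 1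
  rw [mul_one] at this
  rw [this, AddMonoidAlgebra.one_def, AddMonoidAlgebra.coeff_single]
  exact Finsupp.single_eq_of_ne (by decide)

theorem cubicX_pow_three (n : ℕ) : cubicX n ^ 3 = 1 := Units.pow_ofPowEqOne _ _

theorem hasPeriodMultiple_three_three_pow (k : ℕ) :
    HasPeriodMultiple 3 (3 ^ (k + 1)) (2 * 3 ^ (k + 1)) := by
  set n := 3 ^ (k + 1) with hn
  have h3 : 3 ≤ n := ZMod.three_le_three_pow k
  have : Fact (1 < n) := ⟨by omega⟩
  have hx : (cubicX n : CubicMod n) ^ 3 = 1 := congrArg Units.val (cubicX_pow_three n)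
  obtain ⟨T, hT, hord⟩ := exists_unit_sub_two (cubicCoeff n) hx (cubicCoeff_one n)
    (cubicCoeff_X n) (cubicCoeff_X_sq n)
  refine hasPeriodMultiple_of_algebra (cubicX n) (cubicCoeff n)
    (fun w => cubicCoeff_nondegenerate n) (cubicX_pow_three n) (fun _ => ?_) (-2) 1 T ?_ hord
  · refine (orderOf_eq_prime (cubicX_pow_three n) fun h => ?_).symm.dvd
    have := cubicCoeff_X n
    rw [h, Units.val_one, cubicCoeff_one] at this
    exact one_ne_zero this
  · rw [hT, map_neg, map_ofNat, map_one]
    ring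

theorem hasPeriodMultiple_six_three_pow (k : ℕ) :
    HasPeriodMultiple 6 (3 ^ (k + 1)) (2 * 3 ^ (k + 1)) := by
  set n := 3 ^ (k + 1) with hn
  have h3 : 3 ≤ n := ZMod.three_le_three_pow k
  have : Fact (1 < n) := ⟨by omega⟩
  have hx : (cubicX n : CubicMod n) ^ 3 = 1 := congrArg Units.val (cubicX_pow_three n)
  obtain ⟨T, hT, hord⟩ := exists_unit_sub_two (cubicCoeff n) hx (cubicCoeff_one n)
    (cubicCoeff_X n) (cubicCoeff_X_sq n)
  have hcube : (-cubicX n) ^ 3 = -1 := by rw [Odd.neg_pow (by decide), cubicX_pow_three]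
  have hsix : (-cubicX n) ^ 6 = 1 := by rw [show 6 = 3 * 2 by norm_num, pow_mul, hcube, neg_one_sq]
  refine hasPeriodMultiple_of_algebra (-cubicX n) (cubicCoeff n)
    (fun w hw => cubicCoeff_nondegenerate n fun k => ?_) hsix (fun _ => ?_) (-2) (-1) T ?_ hord
  · have := hw k
    rw [Units.val_neg, neg_pow] at this
    rcases neg_one_pow_eq_or (CubicMod n) k with h | h
    · rwa [h, one_mul] at this
    · rwa [h, neg_one_mul, neg_mul, map_neg, neg_eq_zero] at this
  · refine (orderOf_eq_of_pow_and_pow_div_prime (by norm_num) hsix ?_).symm.dvd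
    intro p hp hp6
    rcases Nat.Prime.eq_two_or_three_of_dvd (j := 1) hp hp6 with rfl | rfl
    · rw [show 6 / 2 = 3 by norm_num, hcube]
      intro h
      have := congrArg (fun u : (CubicMod n)ˣ => cubicCoeff n u) h
      simp only [Units.val_neg, Units.val_one, map_neg, cubicCoeff_one] at this
      exact ZMod.neg_one_ne_one_of_three_le h3 this
    · rw [show 6 / 3 = 2 by norm_num, neg_sq]
      intro h
      have h4 := cubicCoeff_X_sq n
      rw [← Units.val_pow_eq_pow_val, h, Units.val_one, cubicCoeff_one] at h4
      exact one_ne_zero h4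
  · rw [hT, map_neg, map_ofNat, map_neg, map_one, Units.val_neg]
    ring

/-- The Eisenstein integers modulo `n` with a square root of `ω` adjoined. -/
abbrev EisensteinRoot (n : ℕ) : Type := QuadraticAlgebra (EisensteinMod n) ⟨0, 1⟩ 0

/-- The adjoined square root of `ω` in `EisensteinRoot n`. -/
def eisensteinRootX (n : ℕ) : (EisensteinRoot n)ˣ where
  val := ⟨0, 1⟩
  inv := ⟨0, ⟨-1, -1⟩⟩
  val_inv := by ext <;> simp [QuadraticAlgebra.re_one, QuadraticAlgebra.im_one]
  inv_val := by ext <;> simp [QuadraticAlgebra.re_one, QuadraticAlgebra.im_one]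

/-- The constant coefficient as a linear form on `EisensteinRoot n`. -/
def eisensteinRootCoeff (n : ℕ) : EisensteinRoot n →ₗ[ZMod n] ZMod n where
  toFun w := w.re.re
  map_add' _ _ := rfl
  map_smul' _ _ := rfl

theorem eisensteinRootX_sq (n : ℕ) :
    (eisensteinRootX n : EisensteinRoot n) ^ 2 = ⟨⟨0, 1⟩, 0⟩ := by
  ext <;> simp [eisensteinRootX, pow_succ]

theorem eisensteinRootX_pow_three (n : ℕ) :
    (eisensteinRootX n : EisensteinRoot n) ^ 3 = ⟨0, ⟨0, 1⟩⟩ := by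
  rw [pow_succ, eisensteinRootX_sq]
  ext <;> simp [eisensteinRootX]

theorem eisensteinRootX_pow_six (n : ℕ) : eisensteinRootX n ^ 6 = 1 := by
  refine Units.ext ?_
  rw [Units.val_pow_eq_pow_val, show 6 = 3 * 2 by norm_num, pow_mul, eisensteinRootX_pow_three]
  ext <;> simp [pow_succ, QuadraticAlgebra.re_one, QuadraticAlgebra.im_one]

theorem orderOf_eisensteinRootX {n : ℕ} (hn : 1 < n) : orderOf (eisensteinRootX n) = 6 := by
  have : Fact (1 < n) := ⟨hn⟩
  refine orderOf_eq_of_pow_and_pow_div_prime (by norm_num) (eisensteinRootX_pow_six n) ?_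
  intro p hp hp6
  rcases Nat.Prime.eq_two_or_three_of_dvd (j := 1) hp hp6 with rfl | rfl
  · rw [show 6 / 2 = 3 by norm_num]
    intro h
    rw [Units.ext_iff, Units.val_pow_eq_pow_val, eisensteinRootX_pow_three] at h
    have := congrArg (fun u : EisensteinRoot n => u.re.re) h
    simp [QuadraticAlgebra.re_one] at this
  · rw [show 6 / 3 = 2 by norm_num]
    intro h
    rw [Units.ext_iff, Units.val_pow_eq_pow_val, eisensteinRootX_sq] at h
    have := congrArg (fun u : EisensteinRoot n => u.re.re) h
    simp [QuadraticAlgebra.re_one] at this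

theorem eisensteinRootCoeff_nondegenerate (n : ℕ) {w : EisensteinRoot n}
    (hw : ∀ k : ℕ, eisensteinRootCoeff n ((eisensteinRootX n : EisensteinRoot n) ^ k * w) = 0) :
    w = 0 := by
  have h0 := hw 0
  have h1 := hw 1
  have h2 := hw 2
  have h3 := hw 3
  rw [pow_zero, one_mul] at h0
  rw [pow_one] at h1
  rw [eisensteinRootX_sq] at h2
  rw [eisensteinRootX_pow_three] at h3
  have h0' : w.re.re = 0 := h0
  have h1' : w.im.im = 0 := by
    simpa [eisensteinRootCoeff, eisensteinRootX] using h1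
  have h2' : w.re.im = 0 := by
    simpa [eisensteinRootCoeff] using h2
  have h3' : w.im.re = 0 := by
    simpa [eisensteinRootCoeff, h1'] using h3
  ext <;> assumption

theorem exists_one_add_rootX_pow (n i : ℕ) :
    ∃ r : ZMod n, (⟨1, 1⟩ : EisensteinRoot n) ^ (3 * 2 ^ (i + 1)) =
      1 + algebraMap (ZMod n) _ (2 ^ (i + 1) * (1 + 2 * r)) * ⟨1, ⟨0, -1⟩⟩ := by
  have he : (⟨1, ⟨0, -1⟩⟩ : EisensteinRoot n) ^ 2 = 2 * ⟨1, ⟨0, -1⟩⟩ := by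
    rw [pow_two, two_mul]
    ext <;> simp [QuadraticAlgebra.re_one, QuadraticAlgebra.im_one]
  induction i with
  | zero =>
    refine ⟨-4, ?_⟩
    have h2 : (⟨1, 1⟩ : EisensteinRoot n) ^ 2 = ⟨⟨1, 1⟩, ⟨2, 0⟩⟩ := by
      rw [pow_two]
      ext <;> simp [QuadraticAlgebra.re_one, QuadraticAlgebra.im_one]
      ring
    have h3 : (⟨⟨1, 1⟩, ⟨2, 0⟩⟩ : EisensteinRoot n) ^ 2 = ⟨⟨0, 5⟩, ⟨4, 4⟩⟩ := by
      rw [pow_two]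
      ext <;> simp <;> ring
    rw [show 3 * 2 ^ (0 + 1) = 2 * 3 by norm_num, pow_mul, h2, pow_succ, h3,
      show (2 ^ (0 + 1) * (1 + 2 * -4) : ZMod n) = -14 by ring, ← Algebra.smul_def]
    ext <;> simp [QuadraticAlgebra.re_one, QuadraticAlgebra.im_one] <;> ring
  | succ i ih =>
    obtain ⟨r, hr⟩ := ih
    rw [pow_succ 2 (i + 1), ← mul_assoc, pow_mul, hr]
    generalize (⟨1, ⟨0, -1⟩⟩ : EisensteinRoot n) = e at he
    refine ⟨r + 2 ^ i * (1 + 2 * r) ^ 2, ?_⟩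
    simp only [map_mul, map_add, map_pow, map_ofNat, map_one]
    generalize algebraMap (ZMod n) (EisensteinRoot n) r = s
    linear_combination (2 ^ (i + 1) * (1 + 2 * s)) ^ 2 * he

theorem exists_one_add_rootX_two_pow (n m : ℕ) :
    ∃ w : EisensteinRoot n, (⟨1, 1⟩ : EisensteinRoot n) ^ 2 ^ (m + 1) = ⟨⟨0, 1⟩, 0⟩ + 2 * w ∨
      (⟨1, 1⟩ : EisensteinRoot n) ^ 2 ^ (m + 1) = ⟨⟨-1, -1⟩, 0⟩ + 2 * w := by
  induction m with
  | zero =>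
    refine ⟨⟨⟨1, 1⟩, 1⟩, Or.inr ?_⟩
    rw [zero_add, pow_one, pow_two, two_mul]
    ext <;> simp [QuadraticAlgebra.re_one, QuadraticAlgebra.im_one]
  | succ m ih =>
    have h1 : (⟨⟨0, 1⟩, 0⟩ : EisensteinRoot n) ^ 2 = ⟨⟨-1, -1⟩, 0⟩ := by
      rw [pow_two]
      ext <;> simp
    have h2 : (⟨⟨-1, -1⟩, 0⟩ : EisensteinRoot n) ^ 2 = ⟨⟨0, 1⟩, 0⟩ := by
      rw [pow_two]
      ext <;> simp
    obtain ⟨w, hw | hw⟩ := ih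
    · refine ⟨2 * ⟨⟨0, 1⟩, 0⟩ * w + 2 * w ^ 2, Or.inr ?_⟩
      rw [pow_succ, pow_mul, hw, ← h1]
      ring
    · refine ⟨2 * ⟨⟨-1, -1⟩, 0⟩ * w + 2 * w ^ 2, Or.inl ?_⟩
      rw [pow_succ, pow_mul, hw, ← h2]
      ring

theorem ZMod.one_add_two_mul_ne_zero (k : ℕ) (r : ZMod (2 ^ (k + 1))) : 1 + 2 * r ≠ 0 :=
  fun h => ZMod.two_pow_mul_odd_ne_zero k r (by rw [h, mul_zero])

theorem hasPeriodMultiple_six_two_pow (j : ℕ) :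
    HasPeriodMultiple 6 (2 ^ (j + 1)) (3 * 2 ^ (j + 1)) := by
  have hn : 1 < 2 ^ (j + 1) := Nat.one_lt_two_pow (by omega)
  rcases j with _ | j
  · exact hasPeriodMultiple_shift (by norm_num) hn
  have h2 : (2 : ZMod (2 ^ (j + 1 + 1))) ^ (j + 1 + 1) = 0 := ZMod.two_pow_eq_zero _
  have hT1 : (⟨1, 1⟩ : EisensteinRoot (2 ^ (j + 1 + 1))) ^ (3 * 2 ^ (j + 1 + 1)) = 1 := by
    obtain ⟨r, hr⟩ := exists_one_add_rootX_pow (2 ^ (j + 1 + 1)) (j + 1)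
    rw [hr, h2, zero_mul, map_zero, zero_mul, add_zero]
  let T : (EisensteinRoot (2 ^ (j + 1 + 1)))ˣ :=
    Units.ofPowEqOne ⟨1, 1⟩ (3 * 2 ^ (j + 1 + 1)) hT1 (by positivity)
  have hTval : (T : EisensteinRoot (2 ^ (j + 1 + 1))) = ⟨1, 1⟩ := rfl
  have hord : orderOf T = 3 * 2 ^ (j + 1 + 1) := by
    refine orderOf_eq_of_pow_and_pow_div_prime (by positivity)
      (Units.ext (by rw [Units.val_pow_eq_pow_val, hTval, hT1]; rfl)) ?_
    intro p hp hdvd h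
    rw [Units.ext_iff, Units.val_pow_eq_pow_val, hTval, Units.val_one] at h
    rcases Nat.Prime.eq_two_or_three_of_dvd hp hdvd with rfl | rfl
    · rw [show 3 * 2 ^ (j + 1 + 1) / 2 = 3 * 2 ^ (j + 1) by
        rw [pow_succ 2 (j + 1), ← mul_assoc]; exact Nat.mul_div_cancel _ (by norm_num)] at h
      obtain ⟨r, hr⟩ := exists_one_add_rootX_pow (2 ^ (j + 1 + 1)) j
      rw [hr, add_eq_left] at h
      have := congrArg (fun u : EisensteinRoot (2 ^ (j + 1 + 1)) => u.re.re) h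
      rw [← Algebra.smul_def] at this
      refine ZMod.two_pow_mul_odd_ne_zero (j + 1) r ?_
      simpa [QuadraticAlgebra.re_one] using this
    · rw [Nat.mul_div_cancel_left _ (by norm_num)] at h
      obtain ⟨w, hw | hw⟩ := exists_one_add_rootX_two_pow (2 ^ (j + 1 + 1)) (j + 1)
      · rw [h] at hw
        have := congrArg (fun u : EisensteinRoot (2 ^ (j + 1 + 1)) => u.re.re) hw
        simp only [two_mul, QuadraticAlgebra.re_one, QuadraticAlgebra.re_add] at this
        exact ZMod.one_add_two_mul_ne_zero (j + 1) (-w.re.re) (by linear_combination this)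
      · rw [h] at hw
        have := congrArg (fun u : EisensteinRoot (2 ^ (j + 1 + 1)) => u.re.im) hw
        simp only [two_mul, QuadraticAlgebra.re_one, QuadraticAlgebra.im_one,
          QuadraticAlgebra.re_add, QuadraticAlgebra.im_add] at this
        exact ZMod.one_add_two_mul_ne_zero (j + 1) (-w.re.im) (by linear_combination this)
  refine hasPeriodMultiple_of_algebra (eisensteinRootX _) (eisensteinRootCoeff _)
    (fun w => eisensteinRootCoeff_nondegenerate _) (eisensteinRootX_pow_six _)
    (fun hn => (orderOf_eisensteinRootX hn).symm.dvd) 1 1 T ?_ hord.symm.dvd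
  rw [hTval, map_one]
  ext <;> simp [eisensteinRootX, QuadraticAlgebra.re_one, QuadraticAlgebra.im_one]

theorem sum_zpow_pow_eq_ite {E : Type*} [CommRing E] {σ : ℕ} (hσ : 0 < σ) {ζ : Eˣ}
    (h1 : ζ ^ σ = 1)
    (h0 : ∀ j, 0 < j → j < σ → ∑ k ∈ Finset.range σ, ((ζ : E) ^ j) ^ k = 0) (y : ℤ) :
    ∑ k ∈ Finset.range σ, ((ζ ^ y : Eˣ) : E) ^ k = if (σ : ℤ) ∣ y then (σ : E) else 0 := by
  have hσ' : (0 : ℤ) < σ := by exact_mod_cast hσ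
  obtain ⟨j, hj⟩ := Int.eq_ofNat_of_zero_le (Int.emod_nonneg y hσ'.ne')
  have hjσ : j < σ := by
    have := Int.emod_lt_of_pos y hσ'
    omega
  have hy : ζ ^ y = ζ ^ j := by
    rw [← Int.emod_add_mul_ediv y σ, hj, zpow_add, zpow_mul, zpow_natCast, zpow_natCast, h1,
      one_zpow, mul_one]
  rw [hy, Units.val_pow_eq_pow_val]
  rcases Nat.eq_zero_or_pos j with rfl | hpos
  · rw [if_pos (Int.dvd_of_emod_eq_zero hj)]
    simp
  · rw [h0 j hpos hjσ, if_neg fun h => ?_]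
    have := Int.emod_eq_zero_of_dvd h
    omega

theorem castHom_refl_eq_zero_of_coprime {σ n : ℕ} (h : σ.Coprime n) (z : ZMod n)
    (hz : (σ : ZMod n) * z = 0) : ZMod.castHom (dvd_refl n) (ZMod n) z = 0 := by
  rw [((ZMod.isUnit_iff_coprime σ n).2 h).mul_right_eq_zero.1 hz, map_zero]

theorem PeriodsDivide.mono {σ n l l' : ℕ} (h : PeriodsDivide σ n l) (hl : l ∣ l') :
    PeriodsDivide σ n l' := by
  obtain ⟨s, rfl⟩ := hl
  exact fun a b ξ hξ t ht hfix => pow_mul_fixed (h a b ξ hξ t ht hfix) s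

theorem PeriodsDivide.mul {σ m n l : ℕ} (hmn : m.Coprime n) (h₁ : PeriodsDivide σ m l)
    (h₂ : PeriodsDivide σ n l) : PeriodsDivide σ (m * n) l := by
  intro a b ξ hξ t ht hfix
  let e := ZMod.chineseRemainder hmn
  let g₁ : ZMod (m * n) →+* ZMod m := (RingHom.fst _ _).comp e.toRingHom
  let g₂ : ZMod (m * n) →+* ZMod n := (RingHom.snd _ _).comp e.toRingHom
  have k₁ := h₁ (g₁ a) (g₁ b) (g₁ ∘ ξ) (fun x => congrArg g₁ (hξ x)) t ht
    (by rw [← comp_linStep_pow, hfix])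
  have k₂ := h₂ (g₂ a) (g₂ b) (g₂ ∘ ξ) (fun x => congrArg g₂ (hξ x)) t ht
    (by rw [← comp_linStep_pow, hfix])
  rw [← comp_linStep_pow] at k₁ k₂
  funext x
  exact e.injective (Prod.ext (congrFun k₁ x) (congrFun k₂ x))

theorem periodsDivide_two {n : ℕ} (hn : 0 < n) : PeriodsDivide 2 n (lambdaTwo (2 * n)) := by
  have : NeZero n := ⟨hn.ne'⟩
  refine periodsDivide_of_fourier (E := ZMod (2 * n)) (by norm_num) (Dvd.intro_left 2 rfl)
    (castHom_eq_zero_of_mul_eq_zero (by norm_num)) Function.injective_id (-1)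
    (sum_zpow_pow_eq_ite (by norm_num) (neg_one_sq) ?_) Monoid.pow_exponent_eq_one
  intro j h0 h2
  obtain rfl : j = 1 := by omega
  simp [Finset.sum_range_succ]

theorem sum_eisensteinOmega (n j : ℕ) (h0 : 0 < j) (h3 : j < 3) :
    ∑ k ∈ Finset.range 3, ((eisensteinOmega n : EisensteinMod n) ^ j) ^ k = 0 := by
  interval_cases j <;> ext <;> simp [Finset.sum_range_succ, eisensteinOmega, pow_succ,
    QuadraticAlgebra.re_one, QuadraticAlgebra.im_one]

theorem sum_eisensteinZeta (n j : ℕ) (h0 : 0 < j) (h6 : j < 6) :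
    ∑ k ∈ Finset.range 6, ((eisensteinZeta n : EisensteinMod n) ^ j) ^ k = 0 := by
  have h : (eisensteinZeta n : EisensteinMod n) ^ 2 = eisensteinZeta n - 1 := by
    ext <;> simp [eisensteinZeta, pow_two, QuadraticAlgebra.re_one, QuadraticAlgebra.im_one]
  generalize (eisensteinZeta n : EisensteinMod n) = z at h
  have h3 : z ^ 3 = -1 := by linear_combination (z + 1) * h
  have hpow : (z ^ j) ^ 3 = (-1) ^ j := by rw [← pow_mul, mul_comm, pow_mul, h3]
  have hsum : ∑ k ∈ Finset.range 6, (z ^ j) ^ k = (1 + z ^ j + (z ^ j) ^ 2) * (1 + (z ^ j) ^ 3) := by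
    simp only [Finset.sum_range_succ, Finset.sum_range_zero]
    ring
  rw [hsum, hpow]
  interval_cases j
  · ring
  · linear_combination (2 * z ^ 2 + 2 * z + 2) * h
  · ring
  · linear_combination (2 * (z ^ 2 + z + 1) * (z ^ 4 - z ^ 2 + 1)) * h
  · ring

theorem sum_gaussianI (n j : ℕ) (h0 : 0 < j) (h4 : j < 4) :
    ∑ k ∈ Finset.range 4, ((gaussianI n : GaussianMod n) ^ j) ^ k = 0 := by
  interval_cases j <;> ext <;> simp [Finset.sum_range_succ, gaussianI, pow_succ,
    QuadraticAlgebra.re_one, QuadraticAlgebra.im_one]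

theorem periodsDivide_three {n : ℕ} (hn : 0 < n) : PeriodsDivide 3 n (lambdaThree (3 * n)) := by
  have : NeZero n := ⟨hn.ne'⟩
  exact periodsDivide_of_fourier (E := EisensteinMod (3 * n)) (by norm_num) (Dvd.intro_left 3 rfl)
    (castHom_eq_zero_of_mul_eq_zero (by norm_num)) QuadraticAlgebra.algebraMap_injective
    (eisensteinOmega _)
    (sum_zpow_pow_eq_ite (by norm_num) (eisensteinOmega_pow_three _) (sum_eisensteinOmega _))
    Monoid.pow_exponent_eq_one

theorem periodsDivide_three_of_coprime {n : ℕ} [NeZero n] (hn : Nat.Coprime 3 n) :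
    PeriodsDivide 3 n (lambdaThree n) :=
  periodsDivide_of_fourier (E := EisensteinMod n) (by norm_num) (dvd_refl n)
    (castHom_refl_eq_zero_of_coprime hn) QuadraticAlgebra.algebraMap_injective
    (eisensteinOmega _)
    (sum_zpow_pow_eq_ite (by norm_num) (eisensteinOmega_pow_three _) (sum_eisensteinOmega _))
    Monoid.pow_exponent_eq_one

theorem periodsDivide_six {n : ℕ} (hn : 0 < n) : PeriodsDivide 6 n (lambdaThree (6 * n)) := by
  have : NeZero n := ⟨hn.ne'⟩
  exact periodsDivide_of_fourier (E := EisensteinMod (6 * n)) (by norm_num) (Dvd.intro_left 6 rfl)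
    (castHom_eq_zero_of_mul_eq_zero (by norm_num)) QuadraticAlgebra.algebraMap_injective
    (eisensteinZeta _)
    (sum_zpow_pow_eq_ite (by norm_num) (eisensteinZeta_pow_six _) (sum_eisensteinZeta _))
    Monoid.pow_exponent_eq_one

theorem periodsDivide_four_of_coprime {n : ℕ} [NeZero n] (hn : Nat.Coprime 4 n) :
    PeriodsDivide 4 n (lambdaFour n) :=
  periodsDivide_of_fourier (E := GaussianMod n) (by norm_num) (dvd_refl n)
    (castHom_refl_eq_zero_of_coprime hn) QuadraticAlgebra.algebraMap_injective
    (gaussianI _)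
    (sum_zpow_pow_eq_ite (by norm_num) (gaussianI_pow_four _) (sum_gaussianI _))
    Monoid.pow_exponent_eq_one

theorem eight_dvd_pow_four_sub_one {A : Type*} [CommRing A] {x : A} (hx : x ^ 4 = 1) {a b : ℤ}
    (h : Odd (a + b)) : (8 : A) ∣ (a + b * x) ^ 4 - 1 := by
  have hodd : ∀ c : ℤ, Odd c → ∃ e : ℤ, c ^ 4 = 1 + 8 * e := by
    rintro c hc
    obtain ⟨e, he⟩ := Int.eight_dvd_sq_sub_one_of_odd hc
    exact ⟨2 * e + 8 * e ^ 2, by linear_combination (c ^ 2 + 1 + 8 * e) * he⟩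
  rcases Int.even_or_odd a with ha | ha
  · obtain ⟨e, he⟩ := hodd b ((Int.odd_add'.1 h).2 ha)
    obtain ⟨c, rfl⟩ := ha.two_dvd
    have he' : (b : A) ^ 4 = 1 + 8 * e := by exact_mod_cast congrArg (Int.cast : ℤ → A) he
    refine ⟨2 * c ^ 4 + 4 * c ^ 3 * b * x + 3 * c ^ 2 * b ^ 2 * x ^ 2 + c * b ^ 3 * x ^ 3 + e, ?_⟩
    push_cast
    linear_combination b ^ 4 * hx + he'
  · obtain ⟨e, he⟩ := hodd a ha
    obtain ⟨c, rfl⟩ := ((Int.odd_add.1 h).1 ha).two_dvd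
    have he' : (a : A) ^ 4 = 1 + 8 * e := by exact_mod_cast congrArg (Int.cast : ℤ → A) he
    refine ⟨2 * c ^ 4 * x ^ 4 + 4 * c ^ 3 * a * x ^ 3 + 3 * c ^ 2 * a ^ 2 * x ^ 2 + c * a ^ 3 * x + e,
      ?_⟩
    push_cast
    linear_combination he'

theorem two_dvd_pow_four {A : Type*} [CommRing A] {x : A} (hx : x ^ 4 = 1) {a b : ℤ}
    (h : Even (a + b)) : (2 : A) ∣ (a + b * x) ^ 4 := by
  obtain ⟨c, hc⟩ := h.two_dvd
  obtain rfl : a = 2 * c - b := by linarith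
  refine ⟨8 * c ^ 4 + 16 * c ^ 3 * (b * (x - 1)) + 12 * c ^ 2 * (b * (x - 1)) ^ 2 +
    4 * c * (b * (x - 1)) ^ 3 + b ^ 4 * (1 - 2 * x + 3 * x ^ 2 - 2 * x ^ 3), ?_⟩
  push_cast
  linear_combination b ^ 4 * hx

open Polynomial in
theorem linStep_pow_eq_of_dvd {R : Type*} [CommRing R] {σ : ℕ} {a b : R} {ξ : ℤ → R}
    (hξ : ∀ x, ξ (x + σ) = ξ x) {m : ℕ} {c : R}
    (h : (X ^ σ - 1 : R[X]) ∣ (C a + C b * X) ^ m - C c) : (linStep a b ^ m) ξ = c • ξ := by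
  have hstep : aeval (linStep (0 : R) 1) (C a + C b * X) = linStep a b := by
    refine LinearMap.ext fun η => funext fun y => ?_
    simp [linStep_apply, Module.algebraMap_end_apply, add_comm]
  have hshift : ∀ k : ℕ, (linStep (0 : R) 1 ^ k) ξ = fun y => ξ (y - k) := by
    intro k
    induction k with
    | zero => funext y; simp
    | succ k ih =>
      rw [pow_succ', Module.End.mul_apply, ih]
      funext y
      simp only [linStep_apply, one_mul, zero_mul, add_zero, Nat.cast_succ]
      congr 1
      ring
  have hann : aeval (linStep (0 : R) 1) (X ^ σ - 1 : R[X]) ξ = 0 := by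
    rw [map_sub, map_pow, aeval_X, map_one, LinearMap.sub_apply, hshift]
    funext y
    have := hξ (y - σ)
    rw [sub_add_cancel] at this
    simp [this]
  obtain ⟨q, hq⟩ := h
  have key := LinearMap.congr_fun (congrArg (aeval (linStep (0 : R) 1)) hq) ξ
  rw [mul_comm _ q, map_mul, Module.End.mul_apply, hann, map_zero, map_sub, map_pow, hstep,
    LinearMap.sub_apply, aeval_C, Module.algebraMap_end_apply] at key
  exact sub_eq_zero.1 key

open Polynomial in
theorem periodsDivide_four_two_pow {k j l : ℕ} (hk : k ≤ j + 3) (hl : 4 * 2 ^ j ∣ l) :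
    PeriodsDivide 4 (2 ^ k) l := by
  refine PeriodsDivide.mono (fun a b ξ hξ t ht hfix => ?_) hl
  obtain ⟨a, rfl⟩ := ZMod.intCast_surjective a
  obtain ⟨b, rfl⟩ := ZMod.intCast_surjective b
  let q : (ZMod (2 ^ k))[X] := X ^ 4 - 1
  have hx : (AdjoinRoot.root q) ^ 4 = 1 := by
    have := AdjoinRoot.mk_self (f := q)
    rwa [map_sub, map_pow, AdjoinRoot.mk_X, map_one, sub_eq_zero] at this
  have h2 : (2 : AdjoinRoot q) ^ k = 0 := by
    have := congrArg (AdjoinRoot.of q) (ZMod.two_pow_eq_zero k)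
    rwa [map_pow, map_ofNat, map_zero] at this
  have hT : AdjoinRoot.mk q (C (a : ZMod (2 ^ k)) + C (b : ZMod (2 ^ k)) * X) =
      a + b * AdjoinRoot.root q := by
    simp
  rcases Int.even_or_odd (a + b) with hab | hab
  · have h0 : (linStep (a : ZMod (2 ^ k)) b ^ (4 * k)) ξ = (0 : ZMod (2 ^ k)) • ξ := by
      refine linStep_pow_eq_of_dvd hξ ?_
      rw [map_zero, sub_zero, ← AdjoinRoot.mk_eq_zero, map_pow, hT, pow_mul]
      obtain ⟨w, hw⟩ := two_dvd_pow_four hx hab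
      rw [hw, mul_pow, h2, zero_mul]
    have hξ0 : ξ = 0 := by
      have h3 := pow_mul_fixed hfix (4 * k)
      obtain ⟨r, rfl⟩ := Nat.exists_eq_succ_of_ne_zero ht.ne'
      rw [Nat.succ_mul, pow_add, Module.End.mul_apply, h0, zero_smul, map_zero] at h3
      exact h3.symm
    rw [hξ0, map_zero]
  · have h1 : (linStep (a : ZMod (2 ^ k)) b ^ (4 * 2 ^ j)) ξ = (1 : ZMod (2 ^ k)) • ξ := by
      refine linStep_pow_eq_of_dvd hξ ?_
      rw [map_one, ← AdjoinRoot.mk_eq_zero, map_sub, map_pow, hT, map_one, pow_mul]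
      have h8 := eight_dvd_pow_four_sub_one hx hab
      have h9 := pow_add_dvd_pow_sub_one (A := AdjoinRoot q) (p := 2) (i := 3) (by norm_num)
        (by norm_num; exact h8) j
      have h10 : ((2 : ℕ) : AdjoinRoot q) ^ (3 + j) = 0 := by
        obtain ⟨r, hr⟩ := Nat.exists_eq_add_of_le hk
        rw [add_comm, hr, pow_add, Nat.cast_ofNat, h2, zero_mul]
      rwa [h10, zero_dvd_iff] at h9
    rw [h1, one_smul]

theorem periodsDivide_four {n : ℕ} (hn : 3 ≤ n) : PeriodsDivide 4 n (lambdaFour n) := by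
  have h4 := four_dvd_lambdaFour hn
  obtain ⟨k, m, hm, rfl⟩ := Nat.exists_eq_pow_mul_and_not_dvd (by omega : n ≠ 0) 2 (by norm_num)
  have hm0 : NeZero m := ⟨by rintro rfl; exact hm (dvd_zero 2)⟩
  have h2m : Nat.Coprime 2 m := (Nat.Prime.coprime_iff_not_dvd Nat.prime_two).2 hm
  have hcop : Nat.Coprime (2 ^ k) m := Nat.Coprime.pow_left k h2m
  have hmul := lambdaFour_mul hcop
  refine PeriodsDivide.mul hcop ?_ ?_
  · rcases Nat.lt_or_ge k 3 with hk | hk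
    · exact periodsDivide_four_two_pow (j := 0) (by omega) (by simpa using h4)
    · obtain ⟨e, rfl⟩ := Nat.exists_eq_add_of_le' hk
      refine periodsDivide_four_two_pow (j := e) le_rfl ?_
      rw [hmul, show 4 * 2 ^ e = 2 ^ (e + 2) by ring]
      exact (two_pow_dvd_lambdaFour e).trans (Nat.dvd_lcm_left _ _)
  · refine (periodsDivide_four_of_coprime (Nat.Coprime.pow_left 2 h2m)).mono ?_
    rw [hmul]
    exact Nat.dvd_lcm_right _ _

theorem hasPeriodMultiple_three_lambdaThree {n : ℕ} (hn : 3 ≤ n) :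
    HasPeriodMultiple 3 n (lambdaThree (3 * n)) := by
  obtain ⟨k, m, hm, rfl⟩ := Nat.exists_eq_pow_mul_and_not_dvd (by omega : n ≠ 0) 3 (by norm_num)
  have hm0 : NeZero m := ⟨by rintro rfl; exact hm (dvd_zero 3)⟩
  have h3m : Nat.Coprime 3 m := (Nat.Prime.coprime_iff_not_dvd Nat.prime_three).2 hm
  have hexp : lambdaThree (3 * (3 ^ k * m)) = (lambdaThree (3 ^ (k + 1))).lcm (lambdaThree m) := by
    rw [← lambdaThree_mul (Nat.Coprime.pow_left _ h3m)]
    congr 1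
    ring
  rw [hexp]
  rcases k with _ | k
  · rw [pow_zero, one_mul] at hn ⊢
    refine (hasPeriodMultiple_three m).mono (Nat.lcm_dvd ?_ dvd_rfl)
    exact lambdaThree_three_dvd.trans (six_dvd_lambdaThree hn)
  · refine HasPeriodMultiple.mono (HasPeriodMultiple.mul (Nat.Coprime.pow_left _ h3m)
      (hasPeriodMultiple_three_three_pow k) (hasPeriodMultiple_three m)) ?_
    exact lcm_dvd_lcm (lambdaThree_three_pow_dvd k) dvd_rfl

theorem hasPeriodMultiple_six_of_coprime_two {n : ℕ} (hn : 2 ≤ n) (hodd : ¬ 2 ∣ n) :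
    HasPeriodMultiple 6 n (Nat.lcm 6 (lambdaThree (3 * n))) := by
  obtain ⟨k, m, hm, rfl⟩ := Nat.exists_eq_pow_mul_and_not_dvd (by omega : n ≠ 0) 3 (by norm_num)
  have hm0 : NeZero m := ⟨by rintro rfl; exact hm (dvd_zero 3)⟩
  have hm2 : m ≠ 2 := by
    rintro rfl
    exact hodd (Dvd.intro_left _ rfl)
  have h3m : Nat.Coprime 3 m := (Nat.Prime.coprime_iff_not_dvd Nat.prime_three).2 hm
  have hexp : lambdaThree (3 * (3 ^ k * m)) = (lambdaThree (3 ^ (k + 1))).lcm (lambdaThree m) := by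
    rw [← lambdaThree_mul (Nat.Coprime.pow_left _ h3m)]
    congr 1
    ring
  rw [hexp]
  rcases k with _ | k
  · rw [pow_zero, one_mul] at hn
    have h6 := six_dvd_lambdaThree (show 3 ≤ m by omega)
    rw [pow_zero, one_mul]
    exact (hasPeriodMultiple_six hm2).mono
      (Nat.lcm_dvd h6 (Nat.lcm_dvd (lambdaThree_three_dvd.trans h6) dvd_rfl))
  · refine HasPeriodMultiple.mono (HasPeriodMultiple.mul (Nat.Coprime.pow_left _ h3m)
      (hasPeriodMultiple_six_three_pow k) (hasPeriodMultiple_six hm2)) ?_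
    refine Nat.lcm_dvd (Dvd.dvd.trans ?_ (Nat.dvd_lcm_left _ _))
      (lcm_dvd_lcm (lambdaThree_three_pow_dvd k) dvd_rfl)
    exact ⟨3 ^ k, by ring⟩

theorem hasPeriodMultiple_six_lambdaThree {n : ℕ} (hn : 2 ≤ n) :
    HasPeriodMultiple 6 n (lambdaThree (6 * n)) := by
  obtain ⟨j, m, hm, rfl⟩ := Nat.exists_eq_pow_mul_and_not_dvd (by omega : n ≠ 0) 2 (by norm_num)
  have hm0 : m ≠ 0 := by rintro rfl; exact hm (dvd_zero 2)
  have h2m : Nat.Coprime 2 m := (Nat.Prime.coprime_iff_not_dvd Nat.prime_two).2 hm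
  have h23 : Nat.Coprime 2 (3 * m) := Nat.Coprime.mul_right (by norm_num) h2m
  have hexp : lambdaThree (6 * (2 ^ j * m)) =
      (lambdaThree (2 ^ (j + 1))).lcm (lambdaThree (3 * m)) := by
    rw [← lambdaThree_mul (Nat.Coprime.pow_left _ h23)]
    congr 1
    ring
  have h2 := lambdaThree_two_pow_dvd j
  rw [hexp]
  rcases j with _ | j
  · rw [pow_zero, one_mul] at hn ⊢
    refine (hasPeriodMultiple_six_of_coprime_two hn hm).mono ?_
    exact lcm_dvd_lcm (h2.trans (by norm_num)) dvd_rfl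
  · have h6 : 6 ∣ 3 * 2 ^ (j + 1) := ⟨2 ^ j, by ring⟩
    rcases Nat.lt_or_ge m 2 with hm1 | hm1
    · obtain rfl : m = 1 := by omega
      rw [mul_one]
      exact (hasPeriodMultiple_six_two_pow j).mono
        (Nat.lcm_dvd h2 (lambdaThree_three_dvd.trans h6))
    · refine HasPeriodMultiple.mono (HasPeriodMultiple.mul (Nat.Coprime.pow_left _ h2m)
        (hasPeriodMultiple_six_two_pow j) (hasPeriodMultiple_six_of_coprime_two hm1 hm)) ?_
      exact lcm_dvd_lcm h2 (Nat.dvd_lcm_right _ _)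

theorem mainTheorem1 :
    (∀ n : ℕ, 2 ≤ n → IsMaxAdditivePeriod 2 n (lambdaTwo (2 * n))) ∧
    IsMaxAdditivePeriod 3 2 3 ∧
    (∀ n : ℕ, 3 ≤ n → IsMaxAdditivePeriod 3 n (lambdaThree (3 * n))) ∧
    IsMaxAdditivePeriod 4 2 4 ∧
    (∀ n : ℕ, 3 ≤ n → IsMaxAdditivePeriod 4 n (lambdaFour n)) ∧
    (∀ n : ℕ, 2 ≤ n → IsMaxAdditivePeriod 6 n (lambdaThree (6 * n))) := by
  refine ⟨fun n hn => ?_, ?_, fun n hn => ?_, ?_, fun n hn => ?_, fun n hn => ?_⟩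
  · have : NeZero n := ⟨by omega⟩
    exact isMaxAdditivePeriod_of hn (by norm_num) (lambdaTwo_pos _) (hasPeriodMultiple_two hn)
      (periodsDivide_two (by omega))
  · exact isMaxAdditivePeriod_of le_rfl (by norm_num) (by norm_num)
      ((hasPeriodMultiple_three 2).mono (three_dvd_lambdaThree (by norm_num)))
      ((periodsDivide_three_of_coprime (by norm_num)).mono
        (by simpa using lambdaThree_two_pow_dvd 0))
  · have : NeZero n := ⟨by omega⟩
    exact isMaxAdditivePeriod_of (by omega) (by norm_num) (lambdaThree_pos _)
      (hasPeriodMultiple_three_lambdaThree hn) (periodsDivide_three (by omega))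
  · exact isMaxAdditivePeriod_of le_rfl (by norm_num) (by norm_num)
      (hasPeriodMultiple_shift (by norm_num) (by norm_num))
      (periodsDivide_four_two_pow (k := 1) (j := 0) (by norm_num) (by norm_num))
  · have : NeZero n := ⟨by omega⟩
    exact isMaxAdditivePeriod_of (by omega) (by norm_num) (lambdaFour_pos _)
      (hasPeriodMultiple_four hn) (periodsDivide_four hn)
  · have : NeZero n := ⟨by omega⟩
    exact isMaxAdditivePeriod_of hn (by norm_num) (lambdaThree_pos _)
      (hasPeriodMultiple_six_lambdaThree hn) (periodsDivide_six (by omega))
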